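/- Let $\alpha>2$, $\gamma>0$, $\sigma>0$, $\lambda_r>0$, $0<\mu_a\le 1$, and write $\Lambda=\mu_a\lambda_r$ for the density of active remote radio heads (RRHs). For $\kappa\ge 0$ put $$\Upsilon_\kappa=\gamma^{2/\alpha}\int_\kappa^\infty\frac{dz}{1+z^{\alpha/2}},\qquad P_{\rm cov}^{\kappa}(\sigma,P)=\pi\Lambda\int_0^\infty e^{-\pi\Lambda(1+\Upsilon_\kappa)v-\gamma\sigma^2v^{\alpha/2}P^{-1}}\,dv ,$$ $$P_{\rm lin}^{\kappa}(\sigma,P)=\pi\Lambda\int_0^\infty e^{-\pi\Lambda(1+\Upsilon_\kappa)v}\bigl(1-\gamma\sigma^2P^{-1}v^{\alpha/2}\bigr)\,dv ,$$ the latter being the former with $e^{-sv^{\alpha/2}}$, $s=\gamma\sigma^2P^{-1}$, replaced by its first-order low-noise approximation, and $$P_c^*(\kappa,\varepsilon)=\frac{L_1}{\Lambda^{\alpha/2}},\qquad L_1=\frac{\gamma\sigma^2\,\Gamma(\frac\alpha2+1)}{\pi^{\alpha/2}\,[1+\Upsilon_\kappa]^{\alpha/2}\,(1-\varepsilon)}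 .$$ (1) For every $\kappa\ge0$ (in particular for $\kappa=0$ and for $\kappa=\gamma^{-2/\alpha}$): (a) for every $P>0$, $P_{\rm cov}^{\kappa}(0,P)=(1+\Upsilon_\kappa)^{-1}=:P_{\rm cov}^{\kappa,\infty}$, $$P_{\rm lin}^{\kappa}(\sigma,P)=P_{\rm cov}^{\kappa,\infty}\Bigl(1-\frac{\gamma\sigma^2\Gamma(\frac\alpha2+1)}{P\,[\pi\Lambda(1+\Upsilon_\kappa)]^{\alpha/2}}\Bigr),$$ $$0\le P_{\rm cov}^{\kappa}(\sigma,P)-P_{\rm lin}^{\kappa}(\sigma,P)\le P_{\rm cov}^{\kappa,\infty}\,\frac{(\gamma\sigma^2/P)^2\,\Gamma(\alpha+1)}{2\,[\pi\Lambda(1+\Upsilon_\kappa)]^{\alpha}} ;$$ (b) for every $\varepsilon\in[0,1)$, $P_c^*(\kappa,\varepsilon)$ is the minimum transmit power $P>0$ for which $P_{\rm lin}^{\kappa}(\sigma,P)\ge\varepsilon P_{\rm cov}^{\kappa,\infty}$; (c) for every $\varepsilon\in(0,1)$ the minimum $P_{\min}(\varepsilon)$ of the powers $P>0$ with $P_{\rm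 cov}^{\kappa}(\sigma,P)\ge\varepsilon P_{\rm cov}^{\kappa,\infty}$ exists, the power $P_c^*(\kappa,\varepsilon)$ itself satisfies this constraint (so $P_{\min}(\varepsilon)\le P_c^*(\kappa,\varepsilon)$), and $P_{\min}(\varepsilon)/P_c^*(\kappa,\varepsilon)\to1$ as $\varepsilon\to1^-$. (2) Let the active RRHs form a homogeneous Poisson point process of density $\Lambda$ in $\mathbb R^2$, all transmitting with power $P$. Let the typical user, at the origin, be served by the nearest one, with i.i.d. fading powers that are exponential of mean $1$ and independent of the positions, path loss $r^{-\alpha}$, noise power $\sigma^2$, and interference from all other active RRHs. Let $P_{\rm cov}$ be the probability that the signal-to-interference-plus-noise ratio exceeds $\gamma$, and $P_{\rm cov}^\infty$ its value for $\sigma=0$. Then $P_{\rm cov}=P_{\rm cov}^{\kappa}$ with $\kappa=\gamma^{-2/\alpha}$, for every $P>0$ and every noise level (zero included). Consequently, for every $\varepsilon\in(0,1)$ the minimum transmit power $P_{\min}(\varepsilon)$ meeting $P_{\rm cov}\ge\varepsilon P_{\rm cov}^\infty$ exists, $P_c^*(\gamma^{-2/\alpha},\varepsilon)$ meets this constraint,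 and $P_{\min}(\varepsilon)/P_c^*(\gamma^{-2/\alpha},\varepsilon)\to1$ as $\varepsilon\to1^-$. -/

import Mathlib

open MeasureTheory ProbabilityTheory Set Filter Topology
open scoped ENNReal NNReal

noncomputable section

namespace ElasticNet

/-! ### The network -/

/-- The number of points of the (enumerated) random configuration `X` that lie in `B`. -/
def pointCount {Ω : Type*} (X : ℕ → Ω → EuclideanSpace ℝ (Fin 2))
    (B : Set (EuclideanSpace ℝ (Fin 2))) (ω : Ω) : ℕ∞ :=
  {n : ℕ | X n ω ∈ B}.encard

/-- `X 0, X 1, …` is an enumeration of the points of a homogeneous Poisson point process of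
density `Λ` on the plane: the number of points in a Borel set of finite area is Poisson with mean
`Λ` times the area, and the numbers of points in finitely many disjoint such sets are
independent. -/
structure IsPoissonPointProcess {Ω : Type*} [MeasurableSpace Ω] (μ : Measure Ω) (Λ : ℝ)
    (X : ℕ → Ω → EuclideanSpace ℝ (Fin 2)) : Prop where
  measurable : ∀ n, Measurable (X n)
  poisson : ∀ B : Set (EuclideanSpace ℝ (Fin 2)), MeasurableSet B → volume B < ∞ →
    ∀ k : ℕ, μ {ω | pointCount X B ω = (k : ℕ∞)} =
      poissonMeasure (Real.toNNReal (Λ * volume.real B)) {k}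
  indep : ∀ (m : ℕ) (B : Fin m → Set (EuclideanSpace ℝ (Fin 2))),
    (∀ i, MeasurableSet (B i)) → (∀ i, volume (B i) < ∞) →
    (Pairwise fun i j => Disjoint (B i) (B j)) →
    iIndepFun (fun i => pointCount X (B i)) μ

/-- The active radio heads sit at the points `X n` of a Poisson point process of density `Λ`; the
power of the channel from the `n`-th one to the typical user at the origin is the fading
coefficient `h n`; these are i.i.d. exponential of mean one (Rayleigh fading), independent of the
positions. -/
structure IsRayleighPoissonNetwork {Ω : Type*} [MeasurableSpace Ω] (μ : Measure Ω) (Λ : ℝ)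
    (X : ℕ → Ω → EuclideanSpace ℝ (Fin 2)) (h : ℕ → Ω → ℝ) : Prop where
  ppp : IsPoissonPointProcess μ Λ X
  measurable_fading : ∀ n, Measurable (h n)
  fading_law : ∀ n, μ.map (h n) = expMeasure 1
  fading_indep : iIndepFun h μ
  indep : IndepFun (fun ω n => X n ω) (fun ω n => h n ω) μ

/-- The power that the typical user at the origin receives from the `n`-th active radio head, at
transmit power `P` and with path-loss exponent `α`. -/
def receivedPower {Ω : Type*} (X : ℕ → Ω → EuclideanSpace ℝ (Fin 2)) (h : ℕ → Ω → ℝ)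
    (α P : ℝ) (n : ℕ) (ω : Ω) : ℝ≥0∞ :=
  ENNReal.ofReal (P * h n ω * ‖X n ω‖ ^ (-α))

/-- The signal-to-interference-plus-noise ratio of the typical user when it is served by the
`n`-th active radio head; all the others interfere, and the noise has power `σ ^ 2`. -/
def sinr {Ω : Type*} (X : ℕ → Ω → EuclideanSpace ℝ (Fin 2)) (h : ℕ → Ω → ℝ)
    (α σ P : ℝ) (n : ℕ) (ω : Ω) : ℝ≥0∞ :=
  receivedPower X h α P n ω /
    (ENNReal.ofReal (σ ^ 2) + ∑' m : {m : ℕ // m ≠ n}, receivedPower X h α P m ω)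

/-- The coverage probability: the probability that the signal-to-interference-plus-noise ratio
of the typical user, served by the nearest active radio head, exceeds the threshold `γ`. -/
def coverageProb {Ω : Type*} [MeasurableSpace Ω] (μ : Measure Ω)
    (X : ℕ → Ω → EuclideanSpace ℝ (Fin 2)) (h : ℕ → Ω → ℝ) (α γ σ P : ℝ) : ℝ :=
  μ.real {ω | ∃ n, (∀ m, m ≠ n → ‖X n ω‖ < ‖X m ω‖) ∧
    ENNReal.ofReal γ < sinr X h α σ P n ω}

/-! ### The coverage formula and its low-noise linearization -/

/-- `γ^(2/α) ∫_κ^∞ dz / (1 + z^(α/2))`. -/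
def upsilon (κ γ α : ℝ) : ℝ :=
  γ ^ (2 / α) * ∫ z in Ioi κ, 1 / (1 + z ^ (α / 2))

/-- The coverage formula
`π Λ ∫_0^∞ exp (-π Λ (1 + Υ) v - γ σ² v^(α/2) P⁻¹) dv`. -/
def covFormula (κ α γ Λ σ P : ℝ) : ℝ :=
  Real.pi * Λ * ∫ v in Ioi (0 : ℝ),
    Real.exp (-(Real.pi * Λ * (1 + upsilon κ γ α) * v) - γ * σ ^ 2 * v ^ (α / 2) * P⁻¹)

/-- The coverage formula with `exp (-s v^(α/2))`, `s = γ σ² P⁻¹`, replaced by its first-order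
approximation `1 - s v^(α/2)`. -/
def covLinear (κ α γ Λ σ P : ℝ) : ℝ :=
  Real.pi * Λ * ∫ v in Ioi (0 : ℝ),
    Real.exp (-(Real.pi * Λ * (1 + upsilon κ γ α) * v)) * (1 - γ * σ ^ 2 * P⁻¹ * v ^ (α / 2))

/-! ### The minimum power -/

/-- The transmit powers that meet the constraint `P_cov ≥ ε P_cov^∞`, for a coverage `cov` that
depends on the noise level and on the power; `P_cov^∞` is the coverage without noise. -/
def feasiblePowers (cov : ℝ → ℝ → ℝ) (σ ε : ℝ) : Set ℝ :=
  {P : ℝ | 0 < P ∧ ε * cov 0 P ≤ cov σ P}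

/-- The constant `L₁`. -/
def L1 (κ α γ σ ε : ℝ) : ℝ :=
  γ * σ ^ 2 * Real.Gamma (α / 2 + 1) /
    (Real.pi ^ (α / 2) * (1 + upsilon κ γ α) ^ (α / 2) * (1 - ε))

/-- The power `P_c* = L₁ / Λ^(α/2)`. -/
def optPower (κ α γ σ Λ ε : ℝ) : ℝ :=
  L1 κ α γ σ ε / Λ ^ (α / 2)

end ElasticNet

end

/-! Because a disc of radius √t has area πt, the squared distances of the points form a homogeneous
Poisson process of rate πΛ on the half-line (`map_norm_sq`), and the nearest squared distance D is
exponential of rate πΛ (`map_first`). Given the positions, the serving fading coefficient exceeds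
the independent noise plus interference I, suitably normalised, with probability E exp(-I)
(`measure_noise_add_interference_lt`). The noise contributes exp(-γσ²P⁻¹D^(α/2)), and an interferer
at squared distance w contributes 1/(1 + γ(D/w)^(α/2)). Written as exp of minus a sum of logarithms,
the product over interferers falls under the Laplace functional (`IsPoisson.lintegral_expNeg_tsum`).
The points beyond the first are again Poisson (`IsPoisson.lintegral_first_point`), so the
interference averages to exp(-πΛΥD). The lower limit κ = γ^(-2/α) in Υ is the image of w = D under z
= w/(γ^(2/α)D). Integrating over the law of D gives the coverage formula.

The power estimates come from 0 ≤ e^(-x) - (1 - x) ≤ x²/2 at x = sv^(α/2), integrated against an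
exponential weight. With C the noiseless coverage this yields C(1 - c/P) ≤ F(P) ≤ C(1 - c/P + d/P²).
The linear constraint solves to P ≥ c/(1 - ε), which is the closed-form power, and the lower bound
makes that power feasible for F. A minimum exists because F is continuous and vanishes as P → 0.
Monotonicity puts the minimum at order 1/(1 - ε), and the upper bound then forces the ratio to 1
(`tendsto_sInf_feasible`).

Exponents take values in [0, ∞]: no summability has to be checked in advance, and the weight ∞
encodes the absence of points. -/

noncomputable section

namespace ElasticNet

/-! ### The function `exp (-x)` on `[0, ∞]` -/

/-- The function `x ↦ exp (-x)` on `[0, ∞]`, with `exp (-∞) = 0`. -/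
def expNeg (x : ℝ≥0∞) : ℝ≥0∞ := EReal.exp (-(x : EReal))

@[simp] lemma expNeg_zero : expNeg 0 = 1 := by simp [expNeg]

@[simp] lemma expNeg_top : expNeg ∞ = 0 := by simp [expNeg]

lemma expNeg_ofReal {x : ℝ} (hx : 0 ≤ x) :
    expNeg (ENNReal.ofReal x) = ENNReal.ofReal (Real.exp (-x)) := by
  rw [expNeg, EReal.coe_ennreal_ofReal, max_eq_left hx, ← EReal.coe_neg, EReal.exp_coe]

lemma expNeg_add (x y : ℝ≥0∞) : expNeg (x + y) = expNeg x * expNeg y := by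
  rw [expNeg, expNeg, expNeg, ← EReal.exp_add, EReal.coe_ennreal_add, EReal.neg_add, sub_eq_add_neg]
  · left; simp
  · right; simp

lemma expNeg_sum {ι : Type*} (s : Finset ι) (f : ι → ℝ≥0∞) :
    expNeg (∑ i ∈ s, f i) = ∏ i ∈ s, expNeg (f i) := by
  classical
  induction s using Finset.induction_on with
  | empty => simp
  | insert a s ha ih => rw [Finset.sum_insert ha, Finset.prod_insert ha, expNeg_add, ih]

lemma continuous_expNeg : Continuous expNeg :=
  ENNReal.continuous_exp.comp (continuous_neg.comp continuous_coe_ennreal_ereal)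

lemma measurable_expNeg : Measurable expNeg := continuous_expNeg.measurable

lemma antitone_expNeg : Antitone expNeg := fun _ _ h =>
  EReal.exp_monotone (EReal.neg_le_neg_iff.2 (EReal.coe_ennreal_le_coe_ennreal_iff.2 h))

lemma expNeg_le_one (x : ℝ≥0∞) : expNeg x ≤ 1 := by
  simpa using antitone_expNeg (zero_le (a := x))

lemma expNeg_ne_top (x : ℝ≥0∞) : expNeg x ≠ ∞ := ((expNeg_le_one x).trans_lt ENNReal.one_lt_top).ne

lemma expNeg_mul_natCast (x : ℝ≥0∞) (n : ℕ) : expNeg (x * n) = expNeg x ^ n := by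
  have := expNeg_sum (Finset.range n) (fun _ => x)
  simpa [mul_comm] using this

lemma expNeg_neg_log {x : ℝ} (hx : 1 ≤ x) :
    expNeg (ENNReal.ofReal (Real.log x)) = ENNReal.ofReal x⁻¹ := by
  rw [expNeg_ofReal (Real.log_nonneg hx), Real.exp_neg, Real.exp_log (by linarith)]

/-! ### Poisson processes -/

section Poisson

variable {Ω E F : Type*} [MeasurableSpace Ω] [MeasurableSpace E] [MeasurableSpace F]

/-- The number of points of `X` in `B`. -/
def count (X : ℕ → Ω → E) (B : Set E) (ω : Ω) : ℕ∞ := {n : ℕ | X n ω ∈ B}.encard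

/-- `X` enumerates a Poisson point process on `E` of intensity measure `ν`. -/
structure IsPoisson (μ : Measure Ω) (ν : Measure E) (X : ℕ → Ω → E) : Prop where
  measurable : ∀ n, Measurable (X n)
  count_law : ∀ B : Set E, MeasurableSet B → ν B < ∞ →
    ∀ k : ℕ, μ {ω | count X B ω = (k : ℕ∞)} = poissonMeasure (ν B).toNNReal {k}
  indep : ∀ (m : ℕ) (B : Fin m → Set E), (∀ i, MeasurableSet (B i)) → (∀ i, ν (B i) < ∞) →
    (Pairwise fun i j => Disjoint (B i) (B j)) → iIndepFun (fun i => count X (B i)) μ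

lemma IsPoisson.map {μ : Measure Ω} {ν : Measure E} {X : ℕ → Ω → E} (hX : IsPoisson μ ν X)
    {f : E → F} (hf : Measurable f) : IsPoisson μ (ν.map f) (fun n ω => f (X n ω)) where
  measurable n := hf.comp (hX.measurable n)
  count_law B hB hB' k := by
    rw [Measure.map_apply hf hB] at *
    exact hX.count_law (f ⁻¹' B) (hf hB) hB' k
  indep m B hB hB' hd := by
    refine hX.indep m (fun i => f ⁻¹' B i) (fun i => hf (hB i)) (fun i => ?_)
      (fun i j hij => (hd hij).preimage f)
    rw [← Measure.map_apply hf (hB i)]; exact hB' i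

lemma tsum_indicator_eq_count {Ω E : Type*} (X : ℕ → Ω → E) (B : Set E) (ω : Ω) :
    ∑' n, B.indicator (1 : E → ℝ≥0∞) (X n ω) = (count X B ω : ℝ≥0∞) := by
  rw [count, ← ENNReal.tsum_set_one, tsum_subtype {n : ℕ | X n ω ∈ B} (fun _ => (1 : ℝ≥0∞))]
  rfl

variable {μ : Measure Ω} {ν : Measure E} {X : ℕ → Ω → E}

lemma IsPoisson.measurable_tsum (hX : IsPoisson μ ν X) {u : E → ℝ≥0∞} (hu : Measurable u) :
    Measurable fun ω => ∑' n, u (X n ω) :=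
  Measurable.tsum fun n => hu.comp (hX.measurable n)

lemma IsPoisson.measurable_count (hX : IsPoisson μ ν X) {B : Set E} (hB : MeasurableSet B) :
    Measurable (count X B) := by
  refine ENat.measurable_iff.2 fun n => ?_
  have h := hX.measurable_tsum (u := B.indicator 1) (measurable_one.indicator hB)
  have : count X B ⁻¹' {(n : ℕ∞)} =
      (fun ω => ∑' m, B.indicator (1 : E → ℝ≥0∞) (X m ω)) ⁻¹' {(n : ℝ≥0∞)} := by
    ext ω
    simp only [mem_preimage, mem_singleton_iff, tsum_indicator_eq_count]
    rw [← ENat.toENNReal_coe, ENat.toENNReal_inj]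
  rw [this]
  exact h (measurableSet_singleton _)

/-- The process axioms fix only the masses at finite counts. These already add up to one, which
forces the mass at `⊤` to vanish. -/
lemma IsPoisson.map_count [IsProbabilityMeasure μ] (hX : IsPoisson μ ν X) {B : Set E}
    (hB : MeasurableSet B) (hB' : ν B < ∞) :
    μ.map (count X B) = (poissonMeasure (ν B).toNNReal).map (fun k : ℕ => (k : ℕ∞)) := by
  have hm := hX.measurable_count hB
  have hc : Measurable (fun k : ℕ => (k : ℕ∞)) := measurable_from_nat
  have h1 : ∀ k : ℕ, μ.map (count X B) {(k : ℕ∞)} =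
      (poissonMeasure (ν B).toNNReal).map (fun k : ℕ => (k : ℕ∞)) {(k : ℕ∞)} := by
    intro k
    rw [Measure.map_apply hm (measurableSet_singleton _),
      Measure.map_apply hc (measurableSet_singleton _)]
    have : (fun k : ℕ => (k : ℕ∞)) ⁻¹' {(k : ℕ∞)} = {k} := by ext; simp
    rw [this]
    exact hX.count_law B hB hB' k
  have p1 : IsProbabilityMeasure (μ.map (count X B)) :=
    Measure.isProbabilityMeasure_map hm.aemeasurable
  have p2 : IsProbabilityMeasure
      ((poissonMeasure (ν B).toNNReal).map (fun k : ℕ => (k : ℕ∞))) :=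
    Measure.isProbabilityMeasure_map hc.aemeasurable
  have hr : ({⊤} : Set ℕ∞)ᶜ = ⋃ k : ℕ, {(k : ℕ∞)} := by
    ext x
    simp only [mem_compl_iff, mem_singleton_iff, mem_iUnion, ENat.ne_top_iff_exists, eq_comm]
  have hd : Pairwise (Function.onFun Disjoint fun k : ℕ => ({(k : ℕ∞)} : Set ℕ∞)) := by
    intro i j hij
    simpa [Function.onFun] using hij
  have h2 : μ.map (count X B) ({⊤} : Set ℕ∞)ᶜ =
      (poissonMeasure (ν B).toNNReal).map (fun k : ℕ => (k : ℕ∞)) ({⊤} : Set ℕ∞)ᶜ := by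
    rw [hr, measure_iUnion hd fun _ => measurableSet_singleton _,
      measure_iUnion hd fun _ => measurableSet_singleton _]
    exact tsum_congr h1
  refine Measure.ext_of_singleton fun a => ?_
  induction a using ENat.recTopCoe with
  | coe k => exact h1 k
  | top =>
    rw [← compl_compl ({⊤} : Set ℕ∞), prob_compl_eq_one_sub (measurableSet_singleton _).compl,
      prob_compl_eq_one_sub (measurableSet_singleton _).compl, h2]

lemma IsPoisson.lintegral_comp_count [IsProbabilityMeasure μ] (hX : IsPoisson μ ν X) {B : Set E}
    (hB : MeasurableSet B) (hB' : ν B < ∞) (f : ℕ∞ → ℝ≥0∞) :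
    ∫⁻ ω, f (count X B ω) ∂μ =
      ∑' k : ℕ, f k * ENNReal.ofReal (Real.exp (-(ν B).toReal) * (ν B).toReal ^ k / k.factorial) := by
  have hm := hX.measurable_count hB
  have hf : Measurable f := measurable_from_top
  rw [← lintegral_map hf hm, hX.map_count hB hB', lintegral_map hf measurable_from_nat,
    lintegral_countable']
  simp_rw [poissonMeasure_singleton]
  rfl

lemma IsPoisson.lintegral_count [IsProbabilityMeasure μ] (hX : IsPoisson μ ν X) {B : Set E}
    (hB : MeasurableSet B) (hB' : ν B < ∞) : ∫⁻ ω, (count X B ω : ℝ≥0∞) ∂μ = ν B := by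
  rw [hX.lintegral_comp_count hB hB' (fun k => (k : ℝ≥0∞)), tsum_eq_zero_add' ENNReal.summable]
  set r := (ν B).toReal with hr
  have hr0 : 0 ≤ r := ENNReal.toReal_nonneg
  have h : ∀ k : ℕ, (((k + 1 : ℕ) : ℕ∞) : ℝ≥0∞) *
      ENNReal.ofReal (Real.exp (-r) * r ^ (k + 1) / (k + 1).factorial) =
      ENNReal.ofReal (r * (Real.exp (-r) * (r ^ k / k.factorial))) := by
    intro k
    rw [ENat.toENNReal_coe, ← ENNReal.ofReal_natCast, ← ENNReal.ofReal_mul (by positivity)]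
    congr 1
    rw [Nat.factorial_succ]
    push_cast
    field_simp
    ring
  simp_rw [h]
  have hs : HasSum (fun k : ℕ => r ^ k / k.factorial) (Real.exp r) := by
    rw [Real.exp_eq_exp_ℝ]; exact NormedSpace.expSeries_div_hasSum_exp r
  have hs' := (hs.mul_left (Real.exp (-r))).mul_left r
  rw [← ENNReal.ofReal_tsum_of_nonneg (fun k => by positivity) hs'.summable, hs'.tsum_eq,
    ← Real.exp_add]
  simp [hr, ENNReal.ofReal_toReal hB'.ne]

/-- The generating function E z^N = exp(-r(1 - z)) of a Poisson variable, at z = exp(-c). The value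
c = ∞, that is z = 0, is included and gives void probabilities. -/
lemma IsPoisson.lintegral_expNeg_mul_count [IsProbabilityMeasure μ] (hX : IsPoisson μ ν X)
    {B : Set E} (hB : MeasurableSet B) (hB' : ν B < ∞) (c : ℝ≥0∞) :
    ∫⁻ ω, expNeg (c * (count X B ω : ℝ≥0∞)) ∂μ = expNeg (ν B * (1 - expNeg c)) := by
  rw [hX.lintegral_comp_count hB hB' (fun k => expNeg (c * (k : ℝ≥0∞)))]
  set r := (ν B).toReal with hr
  have hr0 : 0 ≤ r := ENNReal.toReal_nonneg
  set z := (expNeg c).toReal with hz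
  have hz0 : 0 ≤ z := ENNReal.toReal_nonneg
  have hcz : expNeg c = ENNReal.ofReal z := (ENNReal.ofReal_toReal (expNeg_ne_top c)).symm
  have hz1 : z ≤ 1 := ENNReal.toReal_le_of_le_ofReal zero_le_one (by simpa using expNeg_le_one c)
  have h : ∀ k : ℕ, expNeg (c * ((k : ℕ∞) : ℝ≥0∞)) *
      ENNReal.ofReal (Real.exp (-r) * r ^ k / k.factorial) =
      ENNReal.ofReal (Real.exp (-r) * ((z * r) ^ k / k.factorial)) := by
    intro k
    rw [ENat.toENNReal_coe, expNeg_mul_natCast, hcz, ← ENNReal.ofReal_pow hz0,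
      ← ENNReal.ofReal_mul (by positivity)]
    congr 1
    rw [mul_pow]; ring
  simp_rw [h]
  have hs : HasSum (fun k : ℕ => (z * r) ^ k / k.factorial) (Real.exp (z * r)) := by
    rw [Real.exp_eq_exp_ℝ]; exact NormedSpace.expSeries_div_hasSum_exp (z * r)
  have hs' := hs.mul_left (Real.exp (-r))
  rw [← ENNReal.ofReal_tsum_of_nonneg (fun k => by positivity) hs'.summable, hs'.tsum_eq,
    ← Real.exp_add, hcz, ← ENNReal.ofReal_one, ← ENNReal.ofReal_sub _ hz0,
    ← ENNReal.ofReal_toReal hB'.ne, ← ENNReal.ofReal_mul hr0,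
    expNeg_ofReal (mul_nonneg hr0 (by linarith))]
  congr 2
  ring

/-- **Campbell's formula**: the mean measure of a Poisson process is its intensity. -/
lemma IsPoisson.lintegral_tsum [IsProbabilityMeasure μ] [SigmaFinite ν] (hX : IsPoisson μ ν X)
    {u : E → ℝ≥0∞} (hu : Measurable u) : ∫⁻ ω, ∑' n, u (X n ω) ∂μ = ∫⁻ x, u x ∂ν := by
  -- The superposition of the laws of the points equals ν: on sets of finite measure this is the
  -- Poisson mean, and σ-finiteness extends it by exhaustion.
  have key : Measure.sum (fun n => μ.map (X n)) = ν := by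
    have h1 : ∀ B, MeasurableSet B → ν B < ∞ → Measure.sum (fun n => μ.map (X n)) B = ν B := by
      intro B hB hB'
      rw [Measure.sum_apply _ hB, ← hX.lintegral_count hB hB']
      simp_rw [← tsum_indicator_eq_count]
      rw [MeasureTheory.lintegral_tsum (f := fun n ω => B.indicator (1 : E → ℝ≥0∞) (X n ω))
        fun n => ((measurable_one.indicator hB).comp (hX.measurable n)).aemeasurable]
      refine tsum_congr fun n => ?_
      rw [Measure.map_apply (hX.measurable n) hB, ← lintegral_indicator_one (hX.measurable n hB)]
      rfl
    refine Measure.ext fun B hB => ?_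
    have hun : B = ⋃ k, B ∩ spanningSets ν k := by
      rw [← inter_iUnion, iUnion_spanningSets, inter_univ]
    have hmono : Monotone fun k => B ∩ spanningSets ν k := fun i j hij =>
      inter_subset_inter_right _ (monotone_spanningSets ν hij)
    rw [hun, hmono.measure_iUnion, hmono.measure_iUnion]
    exact iSup_congr fun k => h1 _ (hB.inter (measurableSet_spanningSets ν k))
      ((measure_mono inter_subset_right).trans_lt (measure_spanningSets_lt_top ν k))
  rw [MeasureTheory.lintegral_tsum (f := fun n ω => u (X n ω)) fun n => (hu.comp (hX.measurable n)).aemeasurable]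
  conv_rhs => rw [← key, lintegral_sum_measure]
  exact tsum_congr fun n => (lintegral_map hu (hX.measurable n)).symm

lemma IsPoisson.lintegral_expNeg_sum [IsProbabilityMeasure μ] (hX : IsPoisson μ ν X)
    {m : ℕ} {B : Fin m → Set E} (hB : ∀ i, MeasurableSet (B i)) (hB' : ∀ i, ν (B i) < ∞)
    (hd : Pairwise fun i j => Disjoint (B i) (B j)) (c : Fin m → ℝ≥0∞) :
    ∫⁻ ω, expNeg (∑ i, c i * (count X (B i) ω : ℝ≥0∞)) ∂μ =
      expNeg (∑ i, ν (B i) * (1 - expNeg (c i))) := by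
  simp_rw [expNeg_sum]
  have hf : ∀ i, Measurable (fun k : ℕ∞ => expNeg (c i * (k : ℝ≥0∞))) :=
    fun i => measurable_from_top
  have h := lintegral_prod_eq_prod_lintegral_of_indepFun Finset.univ
    (fun i ω => expNeg (c i * (count X (B i) ω : ℝ≥0∞)))
    ((hX.indep m B hB hB' hd).comp (fun i (k : ℕ∞) => expNeg (c i * (k : ℝ≥0∞))) hf)
    (fun i => (hf i).comp (hX.measurable_count (hB i)))
  rw [h]
  exact Finset.prod_congr rfl fun i _ => hX.lintegral_expNeg_mul_count (hB i) (hB' i) (c i)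

/-- The sum over the points is a weighted sum of counts in the disjoint level sets, and these counts
are independent. -/
lemma IsPoisson.lintegral_expNeg_simpleFunc [IsProbabilityMeasure μ] (hX : IsPoisson μ ν X)
    (s : SimpleFunc E ℝ≥0∞) {S : Set E} (hS : ν S < ∞) (hs : ∀ x, x ∉ S → s x = 0) :
    ∫⁻ ω, expNeg (∑' n, s (X n ω)) ∂μ = expNeg (∫⁻ x, (1 - expNeg (s x)) ∂ν) := by
  classical
  -- The level 0 is discarded: its fibre may have infinite measure, while every other fibre lies in
  -- `S`.
  set R := s.range.filter (· ≠ 0) with hR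
  let e : Fin R.card ≃ R := R.equivFin.symm
  have hne : ∀ i, ((e i : ℝ≥0∞)) ≠ 0 := fun i => (Finset.mem_filter.1 (e i).2).2
  have hB : ∀ i, MeasurableSet (s ⁻¹' {(e i : ℝ≥0∞)}) := fun i => s.measurableSet_fiber _
  have hB' : ∀ i, ν (s ⁻¹' {(e i : ℝ≥0∞)}) < ∞ := fun i => by
    refine (measure_mono fun x hx => ?_).trans_lt hS
    by_contra hxS
    exact hne i ((mem_singleton_iff.1 hx).symm.trans (hs x hxS))
  have hd : Pairwise fun i j => Disjoint (s ⁻¹' {(e i : ℝ≥0∞)}) (s ⁻¹' {(e j : ℝ≥0∞)}) := by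
    intro i j hij
    refine Disjoint.preimage _ (disjoint_singleton.2 fun h => hij ?_)
    exact e.injective (Subtype.ext h)
  have hsum : ∀ (g : ℝ≥0∞ → ℝ≥0∞), g 0 = 0 → ∀ x,
      g (s x) = ∑ i, g (e i) * (s ⁻¹' {(e i : ℝ≥0∞)}).indicator (1 : E → ℝ≥0∞) x := by
    intro g hg x
    rw [e.sum_comp (fun c : R => g c * (s ⁻¹' {(c : ℝ≥0∞)}).indicator (1 : E → ℝ≥0∞) x),
      Finset.sum_coe_sort R (fun c => g c * (s ⁻¹' {c}).indicator (1 : E → ℝ≥0∞) x)]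
    by_cases h0 : s x = 0
    · rw [h0, hg, Finset.sum_eq_zero]
      intro c hc
      have : x ∉ s ⁻¹' {c} := fun h =>
        (Finset.mem_filter.1 hc).2 ((mem_singleton_iff.1 h).symm.trans h0)
      simp [this]
    · rw [Finset.sum_eq_single (s x)]
      · simp
      · intro c _ hc
        have : x ∉ s ⁻¹' {c} := fun h => hc (mem_singleton_iff.1 h).symm
        simp [this]
      · intro h
        exact absurd (Finset.mem_filter.2 ⟨s.mem_range_self x, h0⟩) h
  have h1 : ∀ ω, ∑' n, s (X n ω) =
      ∑ i, (e i : ℝ≥0∞) * (count X (s ⁻¹' {(e i : ℝ≥0∞)}) ω : ℝ≥0∞) := by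
    intro ω
    simp_rw [← tsum_indicator_eq_count, ← ENNReal.tsum_mul_left]
    rw [← Summable.tsum_finsetSum fun _ _ => ENNReal.summable]
    exact tsum_congr fun n => hsum id rfl (X n ω)
  simp_rw [h1]
  rw [hX.lintegral_expNeg_sum hB hB' hd]
  congr 1
  simp_rw [hsum (fun c => 1 - expNeg c) (by simp)]
  rw [lintegral_finsetSum _ fun i _ => (measurable_one.indicator (hB i)).const_mul _]
  refine Finset.sum_congr rfl fun i _ => ?_
  rw [lintegral_const_mul _ (measurable_one.indicator (hB i)), lintegral_indicator_one (hB i),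
    mul_comm]

/-- The **Laplace functional** of a Poisson process. -/
theorem IsPoisson.lintegral_expNeg_tsum [IsProbabilityMeasure μ] [SigmaFinite ν]
    (hX : IsPoisson μ ν X) {u : E → ℝ≥0∞} (hu : Measurable u) :
    ∫⁻ ω, expNeg (∑' n, u (X n ω)) ∂μ = expNeg (∫⁻ x, (1 - expNeg (u x)) ∂ν) := by
  -- Cutting the simple approximations off outside the spanning sets gives supports of finite
  -- measure and keeps the monotone convergence to `u`.
  let s : ℕ → SimpleFunc E ℝ≥0∞ := fun k =>
    (SimpleFunc.eapprox u k).restrict (spanningSets ν k)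
  have hsx : ∀ k x, s k x = (spanningSets ν k).indicator (SimpleFunc.eapprox u k) x := fun k x => by
    rw [SimpleFunc.restrict_apply _ (measurableSet_spanningSets ν k)]
  have hmono : ∀ x, Monotone fun k => s k x := by
    intro x i j hij
    simp only [hsx]
    by_cases hi : x ∈ spanningSets ν i
    · rw [indicator_of_mem hi, indicator_of_mem (monotone_spanningSets ν hij hi)]
      exact SimpleFunc.monotone_eapprox u hij x
    · rw [indicator_of_notMem hi]; exact zero_le
  have hlim : ∀ x, Tendsto (fun k => s k x) atTop (𝓝 (u x)) := by
    intro x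
    refine (SimpleFunc.tendsto_eapprox hu x).congr' ?_
    filter_upwards [eventually_ge_atTop (spanningSetsIndex ν x)] with k hk
    rw [hsx, indicator_of_mem (monotone_spanningSets ν hk (mem_spanningSetsIndex ν x))]
  have hstep : ∀ k, ∫⁻ ω, expNeg (∑' n, s k (X n ω)) ∂μ = expNeg (∫⁻ x, (1 - expNeg (s k x)) ∂ν) :=
    fun k => hX.lintegral_expNeg_simpleFunc (s k) (measure_spanningSets_lt_top ν k)
      fun x hx => by rw [hsx, indicator_of_notMem hx]
  have hL : Tendsto (fun k => ∫⁻ ω, expNeg (∑' n, s k (X n ω)) ∂μ) atTop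
      (𝓝 (∫⁻ ω, expNeg (∑' n, u (X n ω)) ∂μ)) := by
    refine tendsto_lintegral_of_dominated_convergence (fun _ => 1)
      (fun k => measurable_expNeg.comp (hX.measurable_tsum (s k).measurable))
      (fun k => ae_of_all _ fun ω => expNeg_le_one _) (by simp) (ae_of_all _ fun ω => ?_)
    refine (continuous_expNeg.tendsto _).comp ?_
    -- The sum over the points becomes an integral against counting measure, so that monotone
    -- convergence applies.
    simp_rw [← MeasureTheory.lintegral_count]
    exact lintegral_tendsto_of_tendsto_of_monotone (fun k => measurable_from_nat.aemeasurable)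
      (ae_of_all _ fun n => hmono _) (ae_of_all _ fun n => hlim _)
  have hR : Tendsto (fun k => expNeg (∫⁻ x, (1 - expNeg (s k x)) ∂ν)) atTop
      (𝓝 (expNeg (∫⁻ x, (1 - expNeg (u x)) ∂ν))) := by
    refine (continuous_expNeg.tendsto _).comp ?_
    refine lintegral_tendsto_of_tendsto_of_monotone
      (fun k => (measurable_const.sub (measurable_expNeg.comp (s k).measurable)).aemeasurable)
      (ae_of_all _ fun x i j hij => tsub_le_tsub_left (antitone_expNeg (hmono x hij)) 1)
      (ae_of_all _ fun x => ?_)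
    exact ENNReal.Tendsto.sub tendsto_const_nhds ((continuous_expNeg.tendsto _).comp (hlim x))
      (Or.inl ENNReal.one_ne_top)
  simp_rw [hstep] at hL
  exact tendsto_nhds_unique hL hR

end Poisson

/-! ### The first point of a Poisson process on the half-line -/

section FirstPoint

variable {Ω : Type*} [MeasurableSpace Ω] {μ : Measure Ω} {ν : Measure ℝ} {V : ℕ → Ω → ℝ}

/-- Weight ∞ on `(-∞, s]` kills every configuration with a point there, so the event of having none
becomes part of a Laplace functional. -/
lemma expNeg_tsum_top_mul_indicator {Ω : Type*} (V : ℕ → Ω → ℝ) (s : ℝ) (ω : Ω) (y : ℝ≥0∞) :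
    expNeg (∑' n, ∞ * (Iic s).indicator 1 (V n ω) + y) =
      {ω | ∀ n, s < V n ω}.indicator (fun _ => expNeg y) ω := by
  by_cases h : ∀ n, s < V n ω
  · have : ∀ n, ∞ * (Iic s).indicator (1 : ℝ → ℝ≥0∞) (V n ω) = 0 := fun n => by
      rw [indicator_of_notMem (by simpa using h n), mul_zero]
    rw [indicator_of_mem (show ω ∈ {ω | ∀ n, s < V n ω} from h)]
    simp [this]
  · rw [indicator_of_notMem (show ω ∉ {ω | ∀ n, s < V n ω} from h)]
    push Not at h
    obtain ⟨n, hn⟩ := h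
    have : ∑' n, ∞ * (Iic s).indicator (1 : ℝ → ℝ≥0∞) (V n ω) = ∞ := by
      rw [ENNReal.tsum_eq_top_of_eq_top]
      exact ⟨n, by rw [indicator_of_mem (by simpa using hn)]; simp⟩
    simp [this]

lemma IsPoisson.measurableSet_forall_lt (hV : IsPoisson μ ν V) (s : ℝ) :
    MeasurableSet {ω | ∀ n, s < V n ω} := by
  rw [ofPred_forall]
  exact MeasurableSet.iInter fun n => measurableSet_lt measurable_const (hV.measurable n)

/-- Given that no point lies in `(-∞, s]`, the points beyond `s` are still a Poisson process. -/
lemma IsPoisson.setLIntegral_expNeg_tsum [IsProbabilityMeasure μ] [SigmaFinite ν]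
    (hV : IsPoisson μ ν V) {s : ℝ} {u : ℝ → ℝ≥0∞} (hu : Measurable u) (hu0 : ∀ w ≤ s, u w = 0) :
    ∫⁻ ω in {ω | ∀ n, s < V n ω}, expNeg (∑' n, u (V n ω)) ∂μ =
      expNeg (ν (Iic s)) * expNeg (∫⁻ w, (1 - expNeg (u w)) ∂ν) := by
  have hi : Measurable ((Iic s).indicator (1 : ℝ → ℝ≥0∞)) := measurable_one.indicator measurableSet_Iic
  have h := hV.lintegral_expNeg_tsum (u := fun w => ∞ * (Iic s).indicator 1 w + u w)
    ((hi.const_mul ∞).add hu)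
  rw [← lintegral_indicator (hV.measurableSet_forall_lt s)]
  convert h using 1
  · refine lintegral_congr fun ω => ?_
    rw [ENNReal.tsum_add, expNeg_tsum_top_mul_indicator]
    rfl
  · rw [← expNeg_add, ← lintegral_indicator_one measurableSet_Iic, ← lintegral_add_left hi]
    congr 1
    -- As `u` vanishes on `(-∞, s]`, the integrand splits into the indicator of that half-line and
    -- the contribution of `u` alone.
    refine lintegral_congr fun w => ?_
    by_cases hw : w ≤ s
    · rw [indicator_of_mem (by simpa using hw), hu0 w hw]; simp
    · rw [indicator_of_notMem (by simpa using hw)]; simp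

lemma IsPoisson.measure_forall_lt [IsProbabilityMeasure μ] [SigmaFinite ν]
    (hV : IsPoisson μ ν V) (s : ℝ) : μ {ω | ∀ n, s < V n ω} = expNeg (ν (Iic s)) := by
  have h := hV.setLIntegral_expNeg_tsum (s := s) (u := fun _ => 0) measurable_const (fun _ _ => rfl)
  simpa using h

/-- The event says that the first point lies in `(s, t]`. It is a difference of two void events, on
each of which the average of the functional factorises with the same constant; the subtraction is
legitimate because the terms are finite. -/
lemma IsPoisson.setLIntegral_diff_expNeg_tsum [IsProbabilityMeasure μ] [SigmaFinite ν]
    (hV : IsPoisson μ ν V) {s t : ℝ} (hst : s ≤ t) {u : ℝ → ℝ≥0∞} (hu : Measurable u)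
    (hu0 : ∀ w ≤ t, u w = 0) :
    ∫⁻ ω in {ω | ∀ n, s < V n ω} \ {ω | ∀ n, t < V n ω}, expNeg (∑' n, u (V n ω)) ∂μ =
      μ ({ω | ∀ n, s < V n ω} \ {ω | ∀ n, t < V n ω}) *
        expNeg (∫⁻ w, (1 - expNeg (u w)) ∂ν) := by
  have hsub : {ω | ∀ n, t < V n ω} ⊆ {ω | ∀ n, s < V n ω} := fun ω h n => hst.trans_lt (h n)
  have h1 := hV.setLIntegral_expNeg_tsum hu hu0
  have h2 := hV.setLIntegral_expNeg_tsum hu fun w hw => hu0 w (hw.trans hst)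
  rw [← hV.measure_forall_lt] at h1 h2
  have h3 := lintegral_inter_add_sdiff (μ := μ) (fun ω => expNeg (∑' n, u (V n ω)))
    {ω | ∀ n, s < V n ω} (hV.measurableSet_forall_lt t)
  have h4 := measure_inter_add_sdiff (μ := μ) {ω | ∀ n, s < V n ω} (hV.measurableSet_forall_lt t)
  rw [inter_eq_self_of_subset_right hsub] at h3 h4
  rw [h1, h2, ← h4, add_mul] at h3
  exact (ENNReal.add_right_inj (ENNReal.mul_ne_top (measure_ne_top _ _) (expNeg_ne_top _))).1 h3

/-- The law of the first point together with the points beyond it. -/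
theorem IsPoisson.lintegral_first_point [IsProbabilityMeasure μ] [SigmaFinite ν]
    (hV : IsPoisson μ ν V) {D : Ω → ℝ} (hDm : Measurable D) (hD0 : ∀ᵐ ω ∂μ, 0 < D ω)
    (hD : ∀ᵐ ω ∂μ, ∀ s, s < D ω ↔ ∀ n, s < V n ω)
    {u : ℝ → ℝ → ℝ≥0∞} (hu : Measurable (Function.uncurry u)) (hu0 : ∀ t, ∀ w ≤ t, u t w = 0)
    (hcont : ∀ᵐ ω ∂μ, ∀ d : ℕ → ℝ, (∀ k, D ω ≤ d k) → Tendsto d atTop (𝓝 (D ω)) →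
      Tendsto (fun k => ∑' n, u (d k) (V n ω)) atTop (𝓝 (∑' n, u (D ω) (V n ω))))
    {Ψ φ : ℝ → ℝ≥0∞} (hΨ : ∀ t, 0 < t → expNeg (∫⁻ w, (1 - expNeg (u t w)) ∂ν) = Ψ t)
    (hΨc : Continuous Ψ) (hΨ1 : ∀ t, 0 < t → Ψ t ≤ 1) (hφ : Continuous φ) (hφ1 : ∀ t, 0 < t → φ t ≤ 1) :
    ∫⁻ ω, φ (D ω) * expNeg (∑' n, u (D ω) (V n ω)) ∂μ = ∫⁻ ω, φ (D ω) * Ψ (D ω) ∂μ := by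
  -- The first point is rounded up to the grid of mesh 1/(k+1). Upward, because factorisation on a
  -- cell needs `u` to vanish up to the right endpoint of that cell.
  let d : ℕ → Ω → ℝ := fun k ω => (⌈D ω * (k + 1)⌉₊ : ℝ) / (k + 1)
  have hk : ∀ k : ℕ, (0 : ℝ) < k + 1 := fun k => by positivity
  have hdm : ∀ k, Measurable (d k) := fun k =>
    (measurable_from_nat.comp (Nat.measurable_ceil.comp (hDm.mul_const _))).div_const _
  have hd_ge : ∀ k ω, D ω ≤ d k ω := fun k ω => by
    rw [le_div_iff₀ (hk k)]; exact Nat.le_ceil _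
  have hd_le : ∀ k ω, 0 < D ω → d k ω ≤ D ω + 1 / ((k : ℝ) + 1) := fun k ω h => by
    have := (Nat.ceil_lt_add_one (mul_pos h (hk k)).le).le
    rw [div_le_iff₀ (hk k), add_mul, one_div_mul_cancel (hk k).ne']
    exact this
  have hd_lim : ∀ ω, 0 < D ω → Tendsto (fun k => d k ω) atTop (𝓝 (D ω)) := fun ω h => by
    refine tendsto_of_tendsto_of_tendsto_of_le_of_le tendsto_const_nhds ?_
      (fun k => hd_ge k ω) (fun k => hd_le k ω h)
    simpa using tendsto_one_div_add_atTop_nhds_zero_nat.const_add (D ω)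
  have hGm : ∀ T : Ω → ℝ, Measurable T → Measurable fun ω => expNeg (∑' n, u (T ω) (V n ω)) :=
    fun T hT => measurable_expNeg.comp
      (Measurable.tsum fun n => hu.comp (hT.prodMk (hV.measurable n)))
  have hstep : ∀ k, ∫⁻ ω, φ (d k ω) * expNeg (∑' n, u (d k ω) (V n ω)) ∂μ =
      ∫⁻ ω, φ (d k ω) * Ψ (d k ω) ∂μ := by
    intro k
    let A : ℕ → Set Ω := fun i => {ω | ∀ n, (i : ℝ) / (k + 1) < V n ω}
    -- The first point lies in (i/(k+1), (i+1)/(k+1)], so the rounded value on this cell is its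
    -- right endpoint.
    let C : ℕ → Set Ω := fun i => A i \ A (i + 1)
    have hAm : ∀ i, MeasurableSet (A i) := fun i => hV.measurableSet_forall_lt _
    have hCm : ∀ i, MeasurableSet (C i) := fun i => (hAm i).diff (hAm _)
    have hanti : Antitone A := by
      intro i j hij ω h n
      refine lt_of_le_of_lt ?_ (h n)
      exact div_le_div_of_nonneg_right (by exact_mod_cast hij) (hk k).le
    have hCd : Pairwise (Function.onFun Disjoint C) := by
      have hlt : ∀ i j, i < j → Disjoint (C i) (C j) := fun i j hij =>
        disjoint_left.2 fun ω hi hj => hi.2 (hanti (Nat.succ_le_of_lt hij) hj.1)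
      intro i j hij
      rcases lt_or_gt_of_ne hij with h | h
      · exact hlt i j h
      · exact (hlt j i h).symm
    have hmem : ∀ᵐ ω ∂μ, ∀ i, ω ∈ C i ↔ ⌈D ω * (k + 1)⌉₊ = i + 1 := by
      filter_upwards [hD] with ω hω i
      have e1 : ω ∈ C i ↔ (i : ℝ) / (k + 1) < D ω ∧ D ω ≤ ((i + 1 : ℕ) : ℝ) / (k + 1) := by
        rw [← not_lt, hω, hω]; rfl
      rw [e1, div_lt_iff₀ (hk k), le_div_iff₀ (hk k), Nat.ceil_eq_iff (Nat.succ_ne_zero i)]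
      simp
    have hCu : ∀ᵐ ω ∂μ, ω ∈ ⋃ i, C i := by
      filter_upwards [hmem, hD0] with ω h1 h2
      have : 0 < ⌈D ω * (k + 1)⌉₊ := Nat.ceil_pos.2 (mul_pos h2 (hk k))
      exact mem_iUnion.2 ⟨⌈D ω * (k + 1)⌉₊ - 1, (h1 _).2 (by omega)⟩
    have hres : μ.restrict (⋃ i, C i) = μ := Measure.restrict_eq_self_of_ae_mem hCu
    have hsplit : ∀ f : Ω → ℝ≥0∞, ∫⁻ ω, f ω ∂μ = ∑' i, ∫⁻ ω in C i, f ω ∂μ := by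
      intro f
      rw [← lintegral_iUnion hCm hCd, hres]
    rw [hsplit, hsplit]
    refine tsum_congr fun i => ?_
    have hpos : (0 : ℝ) < ((i + 1 : ℕ) : ℝ) / (k + 1) := div_pos (by positivity) (hk k)
    have hval : ∀ᵐ ω ∂μ, ω ∈ C i → d k ω = ((i + 1 : ℕ) : ℝ) / (k + 1) := by
      filter_upwards [hmem] with ω h hi
      simp only [d]
      rw [(h i).1 hi]
    have hL : ∫⁻ ω in C i, φ (d k ω) * expNeg (∑' n, u (d k ω) (V n ω)) ∂μ =
        ∫⁻ ω in C i, φ (((i + 1 : ℕ) : ℝ) / (k + 1)) *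
          expNeg (∑' n, u (((i + 1 : ℕ) : ℝ) / (k + 1)) (V n ω)) ∂μ := by
      refine setLIntegral_congr_fun_ae (hCm i) ?_
      filter_upwards [hval] with ω h hi
      rw [h hi]
    have hR : ∫⁻ ω in C i, φ (d k ω) * Ψ (d k ω) ∂μ =
        ∫⁻ ω in C i, φ (((i + 1 : ℕ) : ℝ) / (k + 1)) * Ψ (((i + 1 : ℕ) : ℝ) / (k + 1)) ∂μ := by
      refine setLIntegral_congr_fun_ae (hCm i) ?_
      filter_upwards [hval] with ω h hi
      rw [h hi]
    have hC : ∫⁻ ω in C i, expNeg (∑' n, u (((i + 1 : ℕ) : ℝ) / (k + 1)) (V n ω)) ∂μ =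
        μ (C i) * Ψ (((i + 1 : ℕ) : ℝ) / (k + 1)) := by
      rw [← hΨ _ hpos]
      exact hV.setLIntegral_diff_expNeg_tsum (div_le_div_of_nonneg_right (by simp) (hk k).le)
        (hu.comp measurable_prodMk_left) (hu0 _)
    rw [hL, hR, lintegral_const_mul _ (hGm _ measurable_const), setLIntegral_const, hC]
    ring
  have hdpos : ∀ k, ∀ᵐ ω ∂μ, 0 < d k ω := fun k => by
    filter_upwards [hD0] with ω h
    exact h.trans_le (hd_ge k ω)
  -- The mesh now tends to 0. The approximations stay at or above the first point, which is all that
  -- `hcont` covers.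
  have h1 : Tendsto (fun k => ∫⁻ ω, φ (d k ω) * expNeg (∑' n, u (d k ω) (V n ω)) ∂μ) atTop
      (𝓝 (∫⁻ ω, φ (D ω) * expNeg (∑' n, u (D ω) (V n ω)) ∂μ)) := by
    refine tendsto_lintegral_of_dominated_convergence (fun _ => 1)
      (fun k => (hφ.measurable.comp (hdm k)).mul (hGm _ (hdm k)))
      (fun k => ?_) (by simp) ?_
    · filter_upwards [hdpos k] with ω h
      exact mul_le_one' (hφ1 _ h) (expNeg_le_one _)
    · filter_upwards [hD0, hcont] with ω h0 hc
      refine ENNReal.Tendsto.mul ((hφ.tendsto _).comp (hd_lim ω h0))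
        (Or.inr (expNeg_ne_top _)) ((continuous_expNeg.tendsto _).comp
          (hc _ (fun k => hd_ge k ω) (hd_lim ω h0)))
        (Or.inr ((hφ1 _ h0).trans_lt ENNReal.one_lt_top).ne)
  have h2 : Tendsto (fun k => ∫⁻ ω, φ (d k ω) * Ψ (d k ω) ∂μ) atTop
      (𝓝 (∫⁻ ω, φ (D ω) * Ψ (D ω) ∂μ)) := by
    refine tendsto_lintegral_of_dominated_convergence (fun _ => 1)
      (fun k => (hφ.measurable.comp (hdm k)).mul (hΨc.measurable.comp (hdm k)))
      (fun k => ?_) (by simp) ?_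
    · filter_upwards [hdpos k] with ω h
      exact mul_le_one' (hφ1 _ h) (hΨ1 _ h)
    · filter_upwards [hD0] with ω h0
      refine ENNReal.Tendsto.mul ((hφ.tendsto _).comp (hd_lim ω h0))
        (Or.inr ((hΨ1 _ h0).trans_lt ENNReal.one_lt_top).ne) ((hΨc.tendsto _).comp
          (hd_lim ω h0))
        (Or.inr ((hφ1 _ h0).trans_lt ENNReal.one_lt_top).ne)
  simp_rw [hstep] at h1
  exact tendsto_nhds_unique h1 h2

end FirstPoint

/-! ### The homogeneous process on the half-line -/

section HalfLine

variable {Ω : Type*} [MeasurableSpace Ω] {μ : Measure Ω} {V : ℕ → Ω → ℝ} {l : ℝ}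

/-- The intensity `l dv` on the half-line `(0, ∞)`. -/
def halfLine (l : ℝ) : Measure ℝ := ENNReal.ofReal l • volume.restrict (Ioi 0)

instance (l : ℝ) : SigmaFinite (halfLine l) := by
  exact inferInstanceAs (SigmaFinite ((Real.toNNReal l) • volume.restrict (Ioi (0 : ℝ))))

lemma halfLine_Ioc (hl : 0 ≤ l) {s t : ℝ} (hs : 0 ≤ s) :
    halfLine l (Ioc s t) = ENNReal.ofReal (l * (t - s)) := by
  have : Ioc s t ∩ Ioi 0 = Ioc s t := inter_eq_left.2 fun x hx => hs.trans_lt hx.1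
  simp [halfLine, Measure.restrict_apply measurableSet_Ioc, this, ENNReal.ofReal_mul hl]

lemma halfLine_Iic (hl : 0 ≤ l) (t : ℝ) : halfLine l (Iic t) = ENNReal.ofReal (l * t) := by
  have : Iic t ∩ Ioi 0 = Ioc 0 t := by ext; simp [and_comm]
  simp [halfLine, Measure.restrict_apply measurableSet_Iic, this, ENNReal.ofReal_mul hl]

/-- The first point is a real infimum. Its default value for families unbounded below plays no role,
since the points are almost surely positive. -/
lemma measurable_first (hV : IsPoisson μ (halfLine l) V) : Measurable fun ω => ⨅ m, V m ω :=
  Measurable.iInf hV.measurable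

variable [IsProbabilityMeasure μ]

lemma ae_pos (hl : 0 ≤ l) (hV : IsPoisson μ (halfLine l) V) : ∀ᵐ ω ∂μ, ∀ n, 0 < V n ω := by
  have h := hV.measure_forall_lt 0
  rw [halfLine_Iic hl] at h
  rw [ae_iff]
  have := prob_compl_eq_zero_iff (μ := μ) (hV.measurableSet_forall_lt 0)
  refine this.2 (by simpa using h)

/-- The number of points in `(-∞, N]` has finite mean, hence is almost surely finite. -/
lemma ae_finite_le (hl : 0 ≤ l) (hV : IsPoisson μ (halfLine l) V) :
    ∀ᵐ ω ∂μ, ∀ K : ℝ, {n | V n ω ≤ K}.Finite := by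
  have h : ∀ N : ℕ, ∀ᵐ ω ∂μ, {n | V n ω ≤ N}.Finite := by
    intro N
    have hc := hV.lintegral_count (B := Iic (N : ℝ)) measurableSet_Iic
      (by rw [halfLine_Iic hl]; exact ENNReal.ofReal_lt_top)
    have hm := hV.measurable_count (B := Iic (N : ℝ)) measurableSet_Iic
    have hm' : Measurable fun ω => (count V (Iic (N : ℝ)) ω : ℝ≥0∞) :=
      (measurable_from_top (f := fun k : ℕ∞ => (k : ℝ≥0∞))).comp hm
    have := ae_lt_top hm' (by rw [hc, halfLine_Iic hl]; exact ENNReal.ofReal_ne_top)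
    filter_upwards [this] with ω hω
    rw [ENat.toENNReal_lt_top] at hω
    exact Set.encard_lt_top_iff.1 hω
  filter_upwards [ae_all_iff.2 h] with ω hω K
  obtain ⟨N, hN⟩ := exists_nat_ge K
  exact (hω N).subset fun n hn => le_trans hn hN

/-- With r the mean, the probability is 1 - e^(-r)(1 + r), at most r² because e^(-r) ≥ 1 - r. -/
lemma measure_two_le_count (hl : 0 ≤ l) (hV : IsPoisson μ (halfLine l) V) {s t : ℝ} (hs : 0 ≤ s)
    (hst : s ≤ t) :
    μ {ω | 2 ≤ count V (Ioc s t) ω} ≤ ENNReal.ofReal ((l * (t - s)) ^ 2) := by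
  have hm := hV.measurable_count (B := Ioc s t) measurableSet_Ioc
  have hν := halfLine_Ioc hl (t := t) hs
  have hfin : halfLine l (Ioc s t) < ∞ := by rw [hν]; exact ENNReal.ofReal_lt_top
  set r := l * (t - s) with hr
  have hr0 : 0 ≤ r := mul_nonneg hl (by linarith)
  have hk : ∀ k : ℕ, μ {ω | count V (Ioc s t) ω = (k : ℕ∞)} =
      ENNReal.ofReal (Real.exp (-r) * r ^ k / k.factorial) := by
    intro k
    rw [hV.count_law _ measurableSet_Ioc hfin, poissonMeasure_singleton, hν]
    rw [show (ENNReal.ofReal r).toNNReal = r.toNNReal from rfl, Real.coe_toNNReal r hr0]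
  have h0 := hk 0
  have h1 := hk 1
  have hdisj : Disjoint {ω | count V (Ioc s t) ω = ((0 : ℕ) : ℕ∞)}
      {ω | count V (Ioc s t) ω = ((1 : ℕ) : ℕ∞)} := by
    rw [disjoint_left]
    intro ω a b
    rw [mem_ofPred_eq] at a b
    rw [a] at b
    simp at b
  have hm0 : ∀ k : ℕ, MeasurableSet {ω | count V (Ioc s t) ω = (k : ℕ∞)} :=
    fun k => hm (measurableSet_singleton _)
  have hun : {ω | 2 ≤ count V (Ioc s t) ω} = ({ω | count V (Ioc s t) ω = ((0 : ℕ) : ℕ∞)} ∪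
      {ω | count V (Ioc s t) ω = ((1 : ℕ) : ℕ∞)})ᶜ := by
    ext ω
    simp only [mem_ofPred_eq, mem_compl_iff, mem_union]
    induction count V (Ioc s t) ω using ENat.recTopCoe with
    | top => simp
    | coe k => norm_cast; omega
  rw [hun, prob_compl_eq_one_sub ((hm0 0).union (hm0 1)), measure_union hdisj (hm0 1), h0, h1,
    ← ENNReal.ofReal_add (by positivity) (by positivity), ← ENNReal.ofReal_one,
    ← ENNReal.ofReal_sub _ (by positivity)]
  refine ENNReal.ofReal_le_ofReal ?_
  have := Real.add_one_le_exp (-r)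
  simp only [pow_zero, mul_one, Nat.factorial_zero, Nat.cast_one, div_one, pow_one, Nat.factorial_one]
  nlinarith

/-- Two coinciding points in (0, K] put at least two indices into one of K(k+1) cells of length
1/(k+1). The union bound is K(k+1)(l/(k+1))² = Kl²/(k+1), which tends to 0. -/
lemma ae_injective (hl : 0 ≤ l) (hV : IsPoisson μ (halfLine l) V) :
    ∀ᵐ ω ∂μ, Function.Injective fun n => V n ω := by
  have key : ∀ K : ℕ, ∀ᵐ ω ∂μ, ∀ n m, n ≠ m → 0 < V n ω → V n ω ≤ K → V n ω ≠ V m ω := by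
    intro K
    rw [ae_iff]
    set T := {ω | ¬∀ n m, n ≠ m → 0 < V n ω → V n ω ≤ K → V n ω ≠ V m ω} with hT
    have hb : ∀ k : ℕ, μ T ≤ ENNReal.ofReal (K * l ^ 2 * (1 / ((k : ℝ) + 1))) := by
      intro k
      have hk : (0 : ℝ) < k + 1 := by positivity
      have hsub : T ⊆ ⋃ i ∈ Finset.range (K * (k + 1)),
          {ω | 2 ≤ count V (Ioc ((i : ℝ) / (k + 1)) (((i + 1 : ℕ) : ℝ) / (k + 1))) ω} := by
        intro ω hω
        simp only [hT, mem_ofPred_eq] at hω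
        push Not at hω
        obtain ⟨n, m, hnm, hpos, hle, heq⟩ := hω
        have hc : 0 < ⌈V n ω * (k + 1)⌉₊ := Nat.ceil_pos.2 (mul_pos hpos hk)
        obtain ⟨i, hi⟩ : ∃ i, ⌈V n ω * (k + 1)⌉₊ = i + 1 := ⟨_, (Nat.succ_pred_eq_of_pos hc).symm⟩
        have hiK : i < K * (k + 1) := by
          have : ⌈V n ω * (k + 1)⌉₊ ≤ K * (k + 1) := by
            rw [Nat.ceil_le]; push_cast
            exact mul_le_mul_of_nonneg_right hle hk.le
          omega
        have hmem : V n ω ∈ Ioc ((i : ℝ) / (k + 1)) (((i + 1 : ℕ) : ℝ) / (k + 1)) := by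
          rw [mem_Ioc, div_lt_iff₀ hk, le_div_iff₀ hk]
          simpa using (Nat.ceil_eq_iff (Nat.succ_ne_zero i)).1 hi
        simp only [mem_iUnion, Finset.mem_range]
        refine ⟨i, hiK, ?_⟩
        have hss : ({n, m} : Set ℕ) ⊆
            {j | V j ω ∈ Ioc ((i : ℝ) / (k + 1)) (((i + 1 : ℕ) : ℝ) / (k + 1))} := by
          rintro j (rfl | rfl)
          · exact hmem
          · show V j ω ∈ Ioc ((i : ℝ) / (k + 1)) (((i + 1 : ℕ) : ℝ) / (k + 1))
            rw [← heq]; exact hmem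
        calc (2 : ℕ∞) = ({n, m} : Set ℕ).encard := (Set.encard_pair hnm).symm
          _ ≤ _ := Set.encard_le_encard hss
      refine (measure_mono hsub).trans ((measure_biUnion_finset_le _ _).trans ?_)
      have : ∀ i ∈ Finset.range (K * (k + 1)),
          μ {ω | 2 ≤ count V (Ioc ((i : ℝ) / (k + 1)) (((i + 1 : ℕ) : ℝ) / (k + 1))) ω} ≤
            ENNReal.ofReal ((l * (1 / ((k : ℝ) + 1))) ^ 2) := by
        intro i _
        refine (measure_two_le_count hl hV (by positivity) ?_).trans (le_of_eq ?_)
        · exact div_le_div_of_nonneg_right (by simp) hk.le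
        · congr 2; push_cast; field_simp; ring
      refine (Finset.sum_le_sum this).trans (le_of_eq ?_)
      rw [Finset.sum_const, Finset.card_range, nsmul_eq_mul, ← ENNReal.ofReal_natCast,
        ← ENNReal.ofReal_mul (by positivity)]
      congr 1
      push_cast
      field_simp
    have hlim : Tendsto (fun k : ℕ => ENNReal.ofReal (K * l ^ 2 * (1 / ((k : ℝ) + 1)))) atTop
        (𝓝 0) := by
      rw [← ENNReal.ofReal_zero]
      refine ENNReal.tendsto_ofReal ?_
      simpa using (tendsto_one_div_add_atTop_nhds_zero_nat (𝕜 := ℝ)).const_mul (K * l ^ 2)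
    exact le_antisymm (ge_of_tendsto' hlim hb) zero_le
  filter_upwards [ae_all_iff.2 key, ae_pos hl hV] with ω h hp n m hnm
  by_contra hne
  obtain ⟨K, hK⟩ := exists_nat_ge (V n ω)
  exact h K n m hne (hp n) hK hnm

/-- Almost surely there is a unique first point, and all points are positive. -/
lemma ae_exists_first (hl : 0 ≤ l) (hV : IsPoisson μ (halfLine l) V) :
    ∀ᵐ ω ∂μ, (∀ n, 0 < V n ω) ∧ ∃ n, (⨅ m, V m ω) = V n ω ∧ ∀ m, m ≠ n → V n ω < V m ω := by
  filter_upwards [ae_pos hl hV, ae_finite_le hl hV, ae_injective hl hV] with ω hp hf hi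
  refine ⟨hp, ?_⟩
  -- Only finitely many points lie at or below the point of index 0, so the infimum is attained
  -- among them.
  obtain ⟨n, hn, hmin⟩ := Set.exists_min_image {n | V n ω ≤ V 0 ω} (fun n => V n ω) (hf _)
    ⟨0, le_refl (V 0 ω)⟩
  have hle : ∀ m, V n ω ≤ V m ω := fun m => by
    rcases le_total (V m ω) (V 0 ω) with h | h
    · exact hmin m h
    · exact le_trans hn h
  refine ⟨n, le_antisymm (ciInf_le ⟨0, ?_⟩ n) (le_ciInf hle), fun m hm =>
    lt_of_le_of_ne (hle m) fun h => hm (hi h).symm⟩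
  rintro _ ⟨m, rfl⟩
  exact (hp m).le

lemma ae_lt_first_iff (hl : 0 ≤ l) (hV : IsPoisson μ (halfLine l) V) :
    ∀ᵐ ω ∂μ, ∀ s, s < (⨅ m, V m ω) ↔ ∀ n, s < V n ω := by
  filter_upwards [ae_exists_first hl hV] with ω ⟨_, n, hn, hlt⟩ s
  rw [hn]
  refine ⟨fun h m => ?_, fun h => h n⟩
  by_cases hm : m = n
  · rwa [hm]
  · exact h.trans (hlt m hm)

/-- The tail of the first point is the void probability of `(-∞, s]`, namely exp(-ls) for s ≥ 0, so
the distribution functions agree. -/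
lemma map_first (hl : 0 < l) (hV : IsPoisson μ (halfLine l) V) :
    μ.map (fun ω => ⨅ m, V m ω) = expMeasure l := by
  have hm := measurable_first hV
  have := isProbabilityMeasure_expMeasure hl
  have : IsProbabilityMeasure (μ.map (fun ω => ⨅ m, V m ω)) :=
    Measure.isProbabilityMeasure_map hm.aemeasurable
  refine Measure.eq_of_cdf _ _ ?_
  ext s
  rw [cdf_expMeasure_eq hl, cdf_eq_real, measureReal_def, Measure.map_apply hm measurableSet_Iic]
  have h1 : (fun ω => ⨅ m, V m ω) ⁻¹' Iic s =ᵐ[μ] {ω | ∀ n, s < V n ω}ᶜ := by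
    filter_upwards [ae_lt_first_iff hl.le hV] with ω h
    apply propext
    show (⨅ m, V m ω) ≤ s ↔ ¬ ∀ n, s < V n ω
    rw [← h, not_lt]
  have h2 : μ ((fun ω => ⨅ m, V m ω) ⁻¹' Iic s) = μ ({ω | ∀ n, s < V n ω}ᶜ : Set Ω) :=
    measure_congr h1
  rw [h2, prob_compl_eq_one_sub (hV.measurableSet_forall_lt s),
    hV.measure_forall_lt, halfLine_Iic hl.le]
  split_ifs with hs
  · rw [expNeg_ofReal (mul_nonneg hl.le hs), ← ENNReal.ofReal_one,
      ← ENNReal.ofReal_sub _ (Real.exp_nonneg _), ENNReal.toReal_ofReal]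
    have : Real.exp (-(l * s)) ≤ 1 := Real.exp_le_one_iff.2 (by nlinarith)
    linarith
  · rw [ENNReal.ofReal_of_nonpos (by nlinarith)]; simp

end HalfLine

/-! ### Rayleigh fading -/

section Fading

variable {Ω : Type*} [MeasurableSpace Ω] {μ : Measure Ω} {h : ℕ → Ω → ℝ}

lemma expMeasure_one_lt_ofReal (i : ℝ≥0∞) :
    expMeasure 1 {y | i < ENNReal.ofReal y} = expNeg i := by
  have := isProbabilityMeasure_expMeasure zero_lt_one
  induction i using ENNReal.recTopCoe with
  | top => simp
  | coe r =>
    have h1 : {y : ℝ | (r : ℝ≥0∞) < ENNReal.ofReal y} = (Iic (r : ℝ))ᶜ := by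
      ext y
      have : (r : ℝ≥0∞) = ENNReal.ofReal r := by simp
      rw [mem_ofPred_eq, this, ENNReal.ofReal_lt_ofReal_iff_of_nonneg r.coe_nonneg]
      simp
    rw [h1, prob_compl_eq_one_sub measurableSet_Iic, ← ofReal_cdf, cdf_expMeasure_eq zero_lt_one,
      if_pos r.coe_nonneg, ← ENNReal.ofReal_one, ← ENNReal.ofReal_sub]
    · have : (r : ℝ≥0∞) = ENNReal.ofReal r := by simp
      rw [this, expNeg_ofReal r.coe_nonneg]
      simp
    · have : Real.exp (-(1 * r)) ≤ 1 := Real.exp_le_one_iff.2 (by simp)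
      linarith

/-- The Laplace transform 1/(1 + c), put as exp(-log(1 + c)) so that products over interferers
become sums of exponents. -/
lemma lintegral_expNeg_expMeasure_one {c : ℝ} (hc : 0 ≤ c) :
    ∫⁻ y, expNeg (ENNReal.ofReal (y * c)) ∂(expMeasure 1) =
      expNeg (ENNReal.ofReal (Real.log (1 + c))) := by
  have hc1 : 0 < 1 + c := by linarith
  have hm : Measurable fun y : ℝ => expNeg (ENNReal.ofReal (y * c)) :=
    measurable_expNeg.comp (by fun_prop)
  have hpdf : Measurable (exponentialPDF 1) := by
    exact (measurable_exponentialPDFReal 1).ennreal_ofReal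
  have hpdf' : Measurable (exponentialPDF (1 + c)) := by
    exact (measurable_exponentialPDFReal (1 + c)).ennreal_ofReal
  have h1 : expMeasure 1 = volume.withDensity (exponentialPDF 1) := rfl
  rw [h1, lintegral_withDensity_eq_lintegral_mul _ hpdf hm, expNeg_neg_log (by linarith)]
  have h2 : ∀ y, (exponentialPDF 1 * fun y : ℝ => expNeg (ENNReal.ofReal (y * c))) y =
      ENNReal.ofReal (1 + c)⁻¹ * exponentialPDF (1 + c) y := by
    intro y
    rw [Pi.mul_apply]
    rcases lt_or_ge y 0 with hy | hy
    · rw [exponentialPDF_of_neg hy, exponentialPDF_of_neg hy]; simp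
    · rw [exponentialPDF_of_nonneg hy, exponentialPDF_of_nonneg hy,
        expNeg_ofReal (mul_nonneg hy hc), ← ENNReal.ofReal_mul (by positivity),
        ← ENNReal.ofReal_mul (by positivity)]
      rw [one_mul, ← Real.exp_add, ← mul_assoc, inv_mul_cancel₀ hc1.ne', one_mul]
      ring_nf
  simp_rw [h2]
  rw [lintegral_const_mul _ hpdf', lintegral_exponentialPDF_eq_one hc1, mul_one]

/-- The σ-algebra is left free, so that it can be the one generated by the coefficients other than
`h n`; that coefficient enters with weight 0. -/
lemma measurable_add_tsum_fading {Ω : Type*} {_ : MeasurableSpace Ω} {h : ℕ → Ω → ℝ} {n : ℕ}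
    {c : ℕ → ℝ} (hcn : c n = 0) (hm : ∀ m, m ≠ n → Measurable (h m)) (b : ℝ≥0∞) :
    Measurable fun ω => b + ∑' m, ENNReal.ofReal (h m ω * c m) := by
  refine Measurable.add measurable_const (Measurable.tsum fun m => ?_)
  by_cases hmn : m = n
  · rw [hmn]; simp only [hcn, mul_zero]; exact measurable_const
  · exact ((hm m hmn).mul_const _).ennreal_ofReal

/-- The two sides are measurable for the σ-algebras generated by disjoint blocks of an independent
family. -/
lemma indepFun_tsum_fading (hm : ∀ n, Measurable (h n)) (hind : iIndepFun h μ) (n : ℕ) {c : ℕ → ℝ}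
    (hcn : c n = 0) (b : ℝ≥0∞) :
    IndepFun (fun ω => b + ∑' m, ENNReal.ofReal (h m ω * c m)) (h n) μ := by
  have hsup := indep_iSup_of_disjoint (fun m => (hm m).comap_le) hind
    (S := {n}ᶜ) (T := {n}) disjoint_compl_left
  rw [IndepFun_iff_Indep]
  refine indep_of_indep_of_le_right (indep_of_indep_of_le_left hsup ?_) ?_
  · rw [← measurable_iff_comap_le]
    refine measurable_add_tsum_fading hcn (fun m hmn => ?_) b
    exact measurable_iff_comap_le.2
      (le_biSup (fun i => MeasurableSpace.comap (h i) _) (show m ∈ ({n}ᶜ : Set ℕ) from hmn))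
  · exact le_biSup (fun i => MeasurableSpace.comap (h i) _) (mem_singleton n)

variable [IsProbabilityMeasure μ]

lemma lintegral_expNeg_tsum_fading (hm : ∀ n, Measurable (h n)) (hlaw : ∀ n, μ.map (h n) = expMeasure 1)
    (hind : iIndepFun h μ) {c : ℕ → ℝ} (hc : ∀ n, 0 ≤ c n) :
    ∫⁻ ω, expNeg (∑' n, ENNReal.ofReal (h n ω * c n)) ∂μ =
      expNeg (∑' n, ENNReal.ofReal (Real.log (1 + c n))) := by
  have hm' : ∀ n, Measurable fun y : ℝ => expNeg (ENNReal.ofReal (y * c n)) := fun n =>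
    measurable_expNeg.comp (by fun_prop)
  have hfin : ∀ N, ∫⁻ ω, expNeg (∑ n ∈ Finset.range N, ENNReal.ofReal (h n ω * c n)) ∂μ =
      expNeg (∑ n ∈ Finset.range N, ENNReal.ofReal (Real.log (1 + c n))) := by
    intro N
    simp_rw [expNeg_sum]
    rw [lintegral_prod_eq_prod_lintegral_of_indepFun (Finset.range N)
      (fun n ω => expNeg (ENNReal.ofReal (h n ω * c n)))
      (hind.comp (fun n y => expNeg (ENNReal.ofReal (y * c n))) hm')
      (fun n => (hm' n).comp (hm n))]
    refine Finset.prod_congr rfl fun n _ => ?_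
    rw [← lintegral_expNeg_expMeasure_one (hc n), ← hlaw n, lintegral_map (hm' n) (hm n)]
  have h1 : Tendsto (fun N => ∫⁻ ω, expNeg (∑ n ∈ Finset.range N, ENNReal.ofReal (h n ω * c n)) ∂μ)
      atTop (𝓝 (∫⁻ ω, expNeg (∑' n, ENNReal.ofReal (h n ω * c n)) ∂μ)) := by
    refine tendsto_lintegral_of_dominated_convergence (fun _ => 1) (fun N => ?_)
      (fun N => ae_of_all _ fun ω => expNeg_le_one _) (by simp) (ae_of_all _ fun ω => ?_)
    · exact measurable_expNeg.comp (Finset.measurable_fun_sum _ fun n _ =>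
        ((hm n).mul_const _).ennreal_ofReal)
    · exact (continuous_expNeg.tendsto _).comp ENNReal.summable.hasSum.tendsto_sum_nat
  simp_rw [hfin] at h1
  exact tendsto_nhds_unique h1
    ((continuous_expNeg.tendsto _).comp ENNReal.summable.hasSum.tendsto_sum_nat)

/-- The probability that an exponential fading coefficient exceeds independent noise and
interference. -/
theorem measure_noise_add_interference_lt (hm : ∀ n, Measurable (h n)) (hlaw : ∀ n, μ.map (h n) = expMeasure 1)
    (hind : iIndepFun h μ) (n : ℕ) {c : ℕ → ℝ} (hc : ∀ m, 0 ≤ c m)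
    (hcn : c n = 0) (b : ℝ≥0∞) :
    μ {ω | b + ∑' m, ENNReal.ofReal (h m ω * c m) < ENNReal.ofReal (h n ω)} =
      expNeg (b + ∑' m, ENNReal.ofReal (Real.log (1 + c m))) := by
  have hI : Measurable fun ω => b + ∑' m, ENNReal.ofReal (h m ω * c m) :=
    measurable_add_tsum_fading hcn (fun m _ => hm m) b
  have hjoint := (indepFun_iff_map_prod_eq_prod_map_map hI.aemeasurable (hm n).aemeasurable).1
    (indepFun_tsum_fading hm hind n hcn b)
  have hS : MeasurableSet {p : ℝ≥0∞ × ℝ | p.1 < ENNReal.ofReal p.2} :=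
    measurableSet_lt measurable_fst measurable_snd.ennreal_ofReal
  have h1 : μ {ω | b + ∑' m, ENNReal.ofReal (h m ω * c m) < ENNReal.ofReal (h n ω)} =
      μ.map (fun ω => (b + ∑' m, ENNReal.ofReal (h m ω * c m), h n ω))
        {p : ℝ≥0∞ × ℝ | p.1 < ENNReal.ofReal p.2} := by
    rw [Measure.map_apply (hI.prodMk (hm n)) hS]; rfl
  have := isProbabilityMeasure_expMeasure zero_lt_one
  rw [h1, hjoint, hlaw n, Measure.prod_apply hS]
  -- With the interference frozen at i, the exponential tail is exp(-i); Fubini then leaves the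
  -- Laplace transform of the interference.
  have h2 : ∀ i : ℝ≥0∞, expMeasure 1 (Prod.mk i ⁻¹' {p : ℝ≥0∞ × ℝ | p.1 < ENNReal.ofReal p.2}) =
      expNeg i := fun i => expMeasure_one_lt_ofReal i
  simp_rw [h2]
  rw [lintegral_map measurable_expNeg hI]
  simp_rw [expNeg_add]
  have h3 : Measurable fun ω => expNeg (∑' m, ENNReal.ofReal (h m ω * c m)) :=
    measurable_expNeg.comp (Measurable.tsum fun m => ((hm m).mul_const _).ennreal_ofReal)
  rw [lintegral_const_mul _ h3, lintegral_expNeg_tsum_fading hm hlaw hind hc]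

end Fading

/-! ### Squared distances of a planar Poisson process -/

section Radial

variable {Ω : Type*} [MeasurableSpace Ω] {μ : Measure Ω} {L : ℝ}
  {X : ℕ → Ω → EuclideanSpace ℝ (Fin 2)}

lemma volume_norm_sq_le (t : ℝ) :
    volume {x : EuclideanSpace ℝ (Fin 2) | ‖x‖ ^ 2 ≤ t} = ENNReal.ofReal (Real.pi * t) := by
  rcases lt_or_ge t 0 with ht | ht
  · have : {x : EuclideanSpace ℝ (Fin 2) | ‖x‖ ^ 2 ≤ t} = ∅ := by
      ext x
      simp only [mem_ofPred_eq, mem_empty_iff_false, iff_false, not_le]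
      exact ht.trans_le (sq_nonneg _)
    rw [this, ENNReal.ofReal_of_nonpos (by nlinarith [Real.pi_pos])]
    simp
  · have : {x : EuclideanSpace ℝ (Fin 2) | ‖x‖ ^ 2 ≤ t} = Metric.closedBall 0 (Real.sqrt t) := by
      ext x
      rw [mem_closedBall_zero_iff, Real.le_sqrt (norm_nonneg _) ht]
      rfl
    rw [this, EuclideanSpace.volume_closedBall_fin_two, ← ENNReal.ofReal_pow (Real.sqrt_nonneg _),
      Real.sq_sqrt ht, ← ENNReal.ofReal_mul ht, mul_comm]

lemma map_norm_sq (hL : 0 ≤ L) :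
    (ENNReal.ofReal L • (volume : Measure (EuclideanSpace ℝ (Fin 2)))).map (fun x => ‖x‖ ^ 2) =
      halfLine (Real.pi * L) := by
  have hm : Measurable fun x : EuclideanSpace ℝ (Fin 2) => ‖x‖ ^ 2 := by fun_prop
  set m := (ENNReal.ofReal L • (volume : Measure (EuclideanSpace ℝ (Fin 2)))).map
    (fun x => ‖x‖ ^ 2) with hmdef
  have h1 : ∀ t, m (Iic t) = ENNReal.ofReal (Real.pi * L * t) := by
    intro t
    rw [hmdef, Measure.map_apply hm measurableSet_Iic]
    have : (fun x : EuclideanSpace ℝ (Fin 2) => ‖x‖ ^ 2) ⁻¹' Iic t = {x | ‖x‖ ^ 2 ≤ t} := rfl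
    rw [this, Measure.smul_apply, volume_norm_sq_le, smul_eq_mul, ← ENNReal.ofReal_mul hL]
    congr 1; ring
  have h2 : ∀ t, halfLine (Real.pi * L) (Iic t) = ENNReal.ofReal (Real.pi * L * t) :=
    halfLine_Iic (mul_nonneg Real.pi_pos.le hL)
  have h3 : ∀ (ρ : Measure ℝ), (∀ t, ρ (Iic t) = ENNReal.ofReal (Real.pi * L * t)) →
      ∀ a b, a < b → ρ (Ioc a b) =
        ENNReal.ofReal (Real.pi * L * b) - ENNReal.ofReal (Real.pi * L * a) := by
    intro ρ hρ a b hab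
    rw [← Iic_sdiff_Iic, measure_sdiff (Iic_subset_Iic.2 hab.le) nullMeasurableSet_Iic, hρ, hρ]
    rw [hρ]; exact ENNReal.ofReal_ne_top
  -- Both measures are finite on bounded intervals, where they are determined by the values on `Iic`
  -- through subtraction.
  refine Measure.ext_of_Ioc' _ _ (fun a b hab => ?_) fun a b hab => ?_
  · rw [h3 m h1 a b hab]
    exact (tsub_le_self.trans_lt ENNReal.ofReal_lt_top).ne
  · rw [h3 m h1 a b hab, h3 _ h2 a b hab]

lemma IsPoissonPointProcess.isPoisson (hL : 0 < L) (hX : IsPoissonPointProcess μ L X) :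
    IsPoisson μ (ENNReal.ofReal L • volume) X := by
  have hfin : ∀ B : Set (EuclideanSpace ℝ (Fin 2)), (ENNReal.ofReal L • volume) B < ∞ →
      volume B < ∞ := by
    intro B hB
    rw [Measure.smul_apply, smul_eq_mul] at hB
    exact ENNReal.lt_top_of_mul_ne_top_right hB.ne (by simpa using hL)
  refine ⟨hX.measurable, fun B hB hB' k => ?_, fun m B hB hB' hd =>
    hX.indep m B hB (fun i => hfin _ (hB' i)) hd⟩
  have : ((ENNReal.ofReal L • volume) B).toNNReal = Real.toNNReal (L * volume.real B) := by
    rw [Measure.smul_apply, smul_eq_mul, ENNReal.toNNReal_mul, Real.toNNReal_mul hL.le,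
      measureReal_def, ENNReal.toNNReal_toReal_eq]
    rfl
  rw [this]
  exact hX.poisson B hB (hfin B hB') k

lemma IsPoissonPointProcess.isPoisson_norm_sq (hL : 0 < L) (hX : IsPoissonPointProcess μ L X) :
    IsPoisson μ (halfLine (Real.pi * L)) (fun n ω => ‖X n ω‖ ^ 2) := by
  rw [← map_norm_sq hL.le]
  exact (hX.isPoisson hL).map (f := fun x => ‖x‖ ^ 2) (by fun_prop)

end Radial

/-! ### The interference of the points beyond the first one -/

section Interference

variable {Ω : Type*} [MeasurableSpace Ω] {μ : Measure Ω} {V : ℕ → Ω → ℝ} {l γ α c : ℝ}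

/-- The exponent by which an interferer at squared distance `w > t` lowers the coverage of a user
served at squared distance `t`. -/
def logInterference (γ β t w : ℝ) : ℝ≥0∞ :=
  if t < w then ENNReal.ofReal (Real.log (1 + γ * (t / w) ^ β)) else 0

lemma measurable_logInterference (γ β : ℝ) :
    Measurable (Function.uncurry (logInterference γ β)) := by
  have : Function.uncurry (logInterference γ β) = fun p : ℝ × ℝ =>
      if p.1 < p.2 then ENNReal.ofReal (Real.log (1 + γ * (p.1 / p.2) ^ β)) else 0 := rfl
  rw [this]
  refine Measurable.ite (measurableSet_lt measurable_fst measurable_snd) ?_ measurable_const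
  fun_prop

lemma integrableOn_one_div_one_add_rpow {β κ : ℝ} (hβ : 1 < β) (hκ : 0 < κ) :
    IntegrableOn (fun z : ℝ => 1 / (1 + z ^ β)) (Ioi κ) := by
  refine Integrable.mono' (integrableOn_Ioi_rpow_of_lt (neg_lt_neg hβ) hκ)
    (Measurable.aestronglyMeasurable (by fun_prop)) ?_
  filter_upwards [ae_restrict_mem measurableSet_Ioi] with z hz
  have hz0 : 0 < z := hκ.trans hz
  have : 0 < z ^ β := Real.rpow_pos_of_pos hz0 _
  rw [Real.norm_of_nonneg (by positivity), Real.rpow_neg hz0.le, ← one_div]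
  exact one_div_le_one_div_of_le this (by linarith)

/-- With k = tγ^(2/α), the integrand for w > t is 1/(1 + (w/k)^(α/2)). Substituting z = w/k turns
the lower limit t into γ^(-2/α) and produces the factor tγ^(2/α). -/
lemma lintegral_one_sub_expNeg_logInterference (hl : 0 ≤ l) (hγ : 0 < γ) (hα : 2 < α) {t : ℝ}
    (ht : 0 < t) :
    ∫⁻ w, (1 - expNeg (logInterference γ (α / 2) t w)) ∂(halfLine l) =
      ENNReal.ofReal (l * upsilon (γ ^ (-(2 / α))) γ α * t) := by
  have hα0 : 0 < α := by linarith
  have hβ : 1 < α / 2 := by linarith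
  set g := γ ^ (2 / α) with hg
  have hg0 : 0 < g := Real.rpow_pos_of_pos hγ _
  set k := t * g with hk
  have hk0 : 0 < k := mul_pos ht hg0
  have hκ : γ ^ (-(2 / α)) = k⁻¹ * t := by
    rw [Real.rpow_neg hγ.le, ← hg, hk]; field_simp
  have hgβ : g ^ (α / 2) = γ := by
    rw [hg, ← Real.rpow_mul hγ.le]
    have : 2 / α * (α / 2) = 1 := by field_simp
    rw [this, Real.rpow_one]
  let F : ℝ → ℝ := fun z => 1 / (1 + z ^ (α / 2))
  have hpt : ∀ w ∈ Ioi (0 : ℝ), 1 - expNeg (logInterference γ (α / 2) t w) =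
      (Ioi t).indicator (fun w => ENNReal.ofReal (F (k⁻¹ * w))) w := by
    intro w hw
    have hw0 : 0 < w := hw
    by_cases htw : t < w
    · rw [indicator_of_mem (by exact htw), logInterference, if_pos htw]
      have hx : 0 < (t / w) ^ (α / 2) := Real.rpow_pos_of_pos (div_pos ht hw0) _
      have hx' : 0 < γ * (t / w) ^ (α / 2) := mul_pos hγ hx
      rw [expNeg_neg_log (by linarith), ← ENNReal.ofReal_one,
        ← ENNReal.ofReal_sub _ (by positivity)]
      congr 1
      have e : (k⁻¹ * w) ^ (α / 2) = (γ * (t / w) ^ (α / 2))⁻¹ := by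
        have : γ * (t / w) ^ (α / 2) = (k / w) ^ (α / 2) := by
          rw [← hgβ, ← Real.mul_rpow hg0.le (div_pos ht hw0).le, hk]
          congr 1; field_simp
        rw [this, ← Real.inv_rpow (div_pos hk0 hw0).le]
        congr 1; field_simp
      simp only [F]
      rw [e]
      field_simp
      ring
    · rw [indicator_of_notMem (by exact htw), logInterference, if_neg htw]
      simp
  have hint : IntegrableOn (fun w => F (k⁻¹ * w)) (Ioi t) := by
    rw [integrableOn_Ioi_comp_mul_left_iff F t (inv_pos.2 hk0)]
    refine integrableOn_one_div_one_add_rpow hβ ?_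
    positivity
  have hIoi : Ioi t ∩ Ioi (0 : ℝ) = Ioi t := inter_eq_left.2 fun x hx => ht.trans hx
  rw [halfLine, lintegral_smul_measure, setLIntegral_congr_fun measurableSet_Ioi hpt,
    lintegral_indicator measurableSet_Ioi, Measure.restrict_restrict measurableSet_Ioi, hIoi,
    ← ofReal_integral_eq_lintegral_ofReal hint, integral_comp_mul_left_Ioi F t (inv_pos.2 hk0),
    smul_eq_mul, ← ENNReal.ofReal_mul hl, upsilon, ← hg, hκ]
  · congr 1
    simp only [F, smul_eq_mul, inv_inv]
    rw [hk]; ring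
  · filter_upwards [ae_restrict_mem measurableSet_Ioi] with w hw
    have : 0 ≤ (k⁻¹ * w) ^ (α / 2) :=
      Real.rpow_nonneg (mul_nonneg (inv_pos.2 hk0).le (ht.trans hw).le) _
    simp only [F, Pi.zero_apply]
    positivity

variable [IsProbabilityMeasure μ]

/-- Beyond 1 the sum has finite mean by Campbell's formula, as β > 1; only finitely many points are
at most 1. -/
lemma ae_tsum_rpow_lt_top (hl : 0 ≤ l) {β : ℝ} (hβ : 1 < β) (hV : IsPoisson μ (halfLine l) V) :
    ∀ᵐ ω ∂μ, ∑' n, ENNReal.ofReal (V n ω ^ (-β)) < ∞ := by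
  have hm : Measurable ((Ioi (1 : ℝ)).indicator fun w => ENNReal.ofReal (w ^ (-β))) :=
    Measurable.indicator (by fun_prop) measurableSet_Ioi
  have hI : ∫⁻ w, (Ioi (1 : ℝ)).indicator (fun w => ENNReal.ofReal (w ^ (-β))) w ∂(halfLine l) ≠ ∞ := by
    have hIoi : Ioi (1 : ℝ) ∩ Ioi (0 : ℝ) = Ioi 1 := inter_eq_left.2 fun x hx => zero_lt_one.trans (mem_Ioi.1 hx)
    rw [halfLine, lintegral_smul_measure, lintegral_indicator measurableSet_Ioi,
      Measure.restrict_restrict measurableSet_Ioi, hIoi]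
    refine ENNReal.mul_ne_top ENNReal.ofReal_ne_top ?_
    have := (integrableOn_Ioi_rpow_of_lt (neg_lt_neg hβ) zero_lt_one).lintegral_lt_top
    exact this.ne
  have h1 := ae_lt_top (hV.measurable_tsum hm) (by rw [hV.lintegral_tsum hm]; exact hI)
  filter_upwards [h1, ae_finite_le hl hV] with ω hω hf
  have hsplit : ∀ n, ENNReal.ofReal (V n ω ^ (-β)) ≤
      (Ioi (1 : ℝ)).indicator (fun w => ENNReal.ofReal (w ^ (-β))) (V n ω) +
        (if n ∈ (hf 1).toFinset then ENNReal.ofReal (V n ω ^ (-β)) else 0) := by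
    intro n
    by_cases hn : V n ω ≤ 1
    · rw [if_pos (by simpa using hn)]; exact le_add_self
    · rw [indicator_of_mem (by simpa using hn)]; exact le_self_add
  refine (ENNReal.tsum_le_tsum hsplit).trans_lt ?_
  rw [ENNReal.tsum_add]
  refine ENNReal.add_lt_top.2 ⟨hω, ?_⟩
  rw [tsum_eq_sum (s := (hf 1).toFinset) fun n hn => by rw [if_neg hn]]
  exact ENNReal.sum_lt_top.2 fun n hn => by rw [if_pos hn]; exact ENNReal.ofReal_lt_top

/-- Convergence holds from the right: points at or before D contribute 0 throughout, and each later
point eventually lies beyond `d k`. Since log(1 + x) ≤ x, the sum of V^(-β) dominates. -/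
lemma ae_tendsto_tsum_logInterference (hl : 0 ≤ l) (hγ : 0 < γ) {β : ℝ} (hβ : 1 < β)
    (hV : IsPoisson μ (halfLine l) V) {D : Ω → ℝ} (hD0 : ∀ᵐ ω ∂μ, 0 < D ω) :
    ∀ᵐ ω ∂μ, ∀ d : ℕ → ℝ, (∀ k, D ω ≤ d k) → Tendsto d atTop (𝓝 (D ω)) →
      Tendsto (fun k => ∑' n, logInterference γ β (d k) (V n ω)) atTop
        (𝓝 (∑' n, logInterference γ β (D ω) (V n ω))) := by
  filter_upwards [ae_tsum_rpow_lt_top hl hβ hV, ae_pos hl hV, hD0] with ω hsum hpos hD d hd hlim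
  have hβ0 : 0 < β := by linarith
  simp_rw [← MeasureTheory.lintegral_count]
  refine tendsto_lintegral_filter_of_dominated_convergence
    (fun n => ENNReal.ofReal (γ * (D ω + 1) ^ β) * ENNReal.ofReal (V n ω ^ (-β)))
    (Eventually.of_forall fun k => measurable_from_nat) ?_ ?_ ?_
  · filter_upwards [hlim.eventually (gt_mem_nhds (lt_add_one (D ω)))] with k hk
    refine ae_of_all _ fun n => ?_
    rw [logInterference]
    split_ifs with h
    · have hdk : 0 < d k := hD.trans_le (hd k)
      have h0 : 0 ≤ (d k / V n ω) ^ β := Real.rpow_nonneg (div_pos hdk (hpos n)).le _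
      rw [← ENNReal.ofReal_mul (by positivity)]
      refine ENNReal.ofReal_le_ofReal ?_
      have h1 := Real.log_le_sub_one_of_pos (show 0 < 1 + γ * (d k / V n ω) ^ β by positivity)
      refine h1.trans ?_
      rw [add_sub_cancel_left, Real.div_rpow hdk.le (hpos n).le, Real.rpow_neg (hpos n).le,
        div_eq_mul_inv, ← mul_assoc]
      refine mul_le_mul_of_nonneg_right (mul_le_mul_of_nonneg_left
        (Real.rpow_le_rpow hdk.le hk.le hβ0.le) hγ.le)
        (inv_nonneg.2 (Real.rpow_nonneg (hpos n).le _))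
    · exact zero_le
  · rw [MeasureTheory.lintegral_count, ENNReal.tsum_mul_left]
    exact ENNReal.mul_ne_top ENNReal.ofReal_ne_top hsum.ne
  · refine ae_of_all _ fun n => ?_
    by_cases h : D ω < V n ω
    · have hev := hlim.eventually (gt_mem_nhds h)
      have : Tendsto (fun k => ENNReal.ofReal (Real.log (1 + γ * (d k / V n ω) ^ β))) atTop
          (𝓝 (ENNReal.ofReal (Real.log (1 + γ * (D ω / V n ω) ^ β)))) := by
        refine ENNReal.tendsto_ofReal (Tendsto.log ?_ ?_)
        · exact (((hlim.div_const _).rpow_const (Or.inr hβ0.le)).const_mul γ).const_add 1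
        · have : 0 ≤ (D ω / V n ω) ^ β := Real.rpow_nonneg (div_pos hD (hpos n)).le _
          positivity
      rw [logInterference, if_pos h]
      refine this.congr' ?_
      filter_upwards [hev] with k hk
      rw [logInterference, if_pos hk]
    · have : ∀ k, logInterference γ β (d k) (V n ω) = 0 := fun k => by
        rw [logInterference, if_neg (not_lt.2 ((not_lt.1 h).trans (hd k)))]
      simp_rw [this]
      rw [logInterference, if_neg h]
      exact tendsto_const_nhds

lemma upsilon_nonneg {κ : ℝ} (hκ : 0 ≤ κ) (hγ : 0 < γ) : 0 ≤ upsilon κ γ α := by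
  refine mul_nonneg (Real.rpow_nonneg hγ.le _) (setIntegral_nonneg measurableSet_Ioi fun z hz => ?_)
  have : 0 ≤ z ^ (α / 2) := Real.rpow_nonneg (hκ.trans (le_of_lt hz)) _
  positivity

lemma integrableOn_exp_neg_sub_rpow {b c β : ℝ} (hb : 0 < b) (hc : 0 ≤ c) :
    IntegrableOn (fun v : ℝ => Real.exp (-(b * v) - c * v ^ β)) (Ioi 0) := by
  refine Integrable.mono' (integrableOn_exp_mul_Ioi (neg_lt_zero.2 hb) 0) (by fun_prop) ?_
  filter_upwards [ae_restrict_mem measurableSet_Ioi] with v hv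
  rw [Real.norm_of_nonneg (Real.exp_nonneg _)]
  refine Real.exp_le_exp.2 ?_
  have : 0 ≤ v ^ β := Real.rpow_nonneg (le_of_lt hv) _
  nlinarith

/-- The mean of the conditional coverage probability given the positions. -/
theorem lintegral_expNeg_first_logInterference (hl : 0 < l) (hγ : 0 < γ) (hα : 2 < α) (hc : 0 ≤ c)
    (hV : IsPoisson μ (halfLine l) V) :
    ∫⁻ ω, ENNReal.ofReal (Real.exp (-(c * (⨅ n, V n ω) ^ (α / 2)))) *
        expNeg (∑' n, logInterference γ (α / 2) (⨅ n, V n ω) (V n ω)) ∂μ =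
      ENNReal.ofReal (l * ∫ v in Ioi (0 : ℝ),
        Real.exp (-(l * (1 + upsilon (γ ^ (-(2 / α))) γ α) * v) - c * v ^ (α / 2))) := by
  have hβ0 : 0 < α / 2 := by linarith
  set U := upsilon (γ ^ (-(2 / α))) γ α with hU
  have hU0 : 0 ≤ U := upsilon_nonneg (Real.rpow_nonneg hγ.le _) hγ
  have hDm := measurable_first hV
  have hD0 : ∀ᵐ ω ∂μ, 0 < ⨅ n, V n ω := by
    filter_upwards [ae_exists_first hl.le hV] with ω ⟨hp, n, hn, _⟩
    rw [hn]; exact hp n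
  have hφ1 : ∀ t : ℝ, 0 < t → ENNReal.ofReal (Real.exp (-(c * t ^ (α / 2)))) ≤ 1 := by
    intro t ht
    rw [ENNReal.ofReal_le_one, Real.exp_le_one_iff]
    have : 0 ≤ t ^ (α / 2) := Real.rpow_nonneg ht.le _
    nlinarith
  have hφc : Continuous fun t : ℝ => ENNReal.ofReal (Real.exp (-(c * t ^ (α / 2)))) := by
    refine ENNReal.continuous_ofReal.comp (Real.continuous_exp.comp (Continuous.neg ?_))
    exact continuous_const.mul (Real.continuous_rpow_const hβ0.le)
  have hΨc : Continuous fun t : ℝ => ENNReal.ofReal (Real.exp (-(l * U * t))) := by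
    refine ENNReal.continuous_ofReal.comp ?_
    fun_prop
  -- The interference is replaced by its mean exp(-lUD) given D; only an integral over the
  -- exponential law of D remains.
  rw [hV.lintegral_first_point hDm hD0 (ae_lt_first_iff hl.le hV)
    (measurable_logInterference γ (α / 2))
    (fun t w hw => by rw [logInterference, if_neg (not_lt.2 hw)])
    (ae_tendsto_tsum_logInterference hl.le hγ (by linarith) hV hD0)
    (Ψ := fun t => ENNReal.ofReal (Real.exp (-(l * U * t))))
    (φ := fun t => ENNReal.ofReal (Real.exp (-(c * t ^ (α / 2)))))
    (fun t ht => ?_) hΨc (fun t ht => ?_) hφc hφ1]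
  · have hm : Measurable fun v : ℝ => ENNReal.ofReal (Real.exp (-(c * v ^ (α / 2)))) *
        ENNReal.ofReal (Real.exp (-(l * U * v))) := hφc.measurable.mul hΨc.measurable
    have hpdf : Measurable (exponentialPDF l) := (measurable_exponentialPDFReal l).ennreal_ofReal
    have e1 : expMeasure l = volume.withDensity (exponentialPDF l) := rfl
    have e2 : ∀ v, (exponentialPDF l * fun v : ℝ =>
        ENNReal.ofReal (Real.exp (-(c * v ^ (α / 2)))) * ENNReal.ofReal (Real.exp (-(l * U * v)))) v =
        (Ici (0 : ℝ)).indicator (fun v => ENNReal.ofReal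
          (l * Real.exp (-(l * (1 + U) * v) - c * v ^ (α / 2)))) v := by
      intro v
      rw [Pi.mul_apply]
      rcases lt_or_ge v 0 with hv | hv
      · rw [exponentialPDF_of_neg hv, indicator_of_notMem (by simpa using hv), zero_mul]
      · rw [exponentialPDF_of_nonneg hv, indicator_of_mem (by exact hv),
          ← ENNReal.ofReal_mul (by positivity), ← ENNReal.ofReal_mul (by positivity)]
        congr 1
        rw [mul_assoc, ← Real.exp_add, ← Real.exp_add]
        congr 2; ring
    rw [← lintegral_map (f := fun v : ℝ => ENNReal.ofReal (Real.exp (-(c * v ^ (α / 2)))) *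
        ENNReal.ofReal (Real.exp (-(l * U * v)))) hm hDm, map_first hl hV, e1,
      lintegral_withDensity_eq_lintegral_mul _ hpdf hm]
    simp_rw [e2]
    have hint := (integrableOn_exp_neg_sub_rpow (β := α / 2)
      (show 0 < l * (1 + U) by positivity) hc).const_mul l
    rw [lintegral_indicator measurableSet_Ici, setLIntegral_congr Ioi_ae_eq_Ici.symm,
      ← ofReal_integral_eq_lintegral_ofReal hint (ae_of_all _ fun v => by
        simp only [Pi.zero_apply]; positivity), integral_const_mul]
  · rw [lintegral_one_sub_expNeg_logInterference hl.le hγ hα ht, expNeg_ofReal (by positivity)]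
  · rw [ENNReal.ofReal_le_one, Real.exp_le_one_iff]
    have : 0 ≤ l * U * t := by positivity
    linarith

end Interference

/-! ### The coverage probability of the network -/

section Coverage

variable {Ω : Type*} [MeasurableSpace Ω] {μ : Measure Ω} [IsProbabilityMeasure μ] {L γ α : ℝ}
  {X : ℕ → Ω → EuclideanSpace ℝ (Fin 2)} {h : ℕ → Ω → ℝ}

/-- The configurations of positions and fading coefficients for which the user is covered. -/
def coveredConfigs (α γ τ P : ℝ) : Set ((ℕ → EuclideanSpace ℝ (Fin 2)) × (ℕ → ℝ)) :=
  {p | ∃ n, (∀ m, m ≠ n → ‖p.1 n‖ < ‖p.1 m‖) ∧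
    ENNReal.ofReal γ < ENNReal.ofReal (P * p.2 n * ‖p.1 n‖ ^ (-α)) /
      (ENNReal.ofReal (τ ^ 2) +
        ∑' m : {m : ℕ // m ≠ n}, ENNReal.ofReal (P * p.2 m * ‖p.1 m‖ ^ (-α)))}

lemma measurableSet_coveredConfigs (α γ τ P : ℝ) : MeasurableSet (coveredConfigs α γ τ P) := by
  have hn : ∀ n : ℕ, Measurable fun p : (ℕ → EuclideanSpace ℝ (Fin 2)) × (ℕ → ℝ) => ‖p.1 n‖ :=
    fun n => ((measurable_pi_apply n).comp measurable_fst).norm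
  have hr : ∀ n : ℕ, Measurable fun p : (ℕ → EuclideanSpace ℝ (Fin 2)) × (ℕ → ℝ) =>
      ENNReal.ofReal (P * p.2 n * ‖p.1 n‖ ^ (-α)) := fun n =>
    ((((measurable_pi_apply n).comp measurable_snd).const_mul P).mul
      ((hn n).pow_const _)).ennreal_ofReal
  have hset : coveredConfigs α γ τ P = ⋃ n, ((⋂ m, ⋂ (_ : m ≠ n), {p | ‖p.1 n‖ < ‖p.1 m‖}) ∩
      {p | ENNReal.ofReal γ < ENNReal.ofReal (P * p.2 n * ‖p.1 n‖ ^ (-α)) /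
        (ENNReal.ofReal (τ ^ 2) +
          ∑' m : {m : ℕ // m ≠ n}, ENNReal.ofReal (P * p.2 m * ‖p.1 m‖ ^ (-α)))}) := by
    ext p; simp [coveredConfigs]
  rw [hset]
  refine MeasurableSet.iUnion fun n => MeasurableSet.inter ?_ ?_
  · exact MeasurableSet.iInter fun m => MeasurableSet.iInter fun _ => measurableSet_lt (hn n) (hn m)
  · exact measurableSet_lt measurable_const ((hr n).div (measurable_const.add
      (Measurable.tsum fun m : {m : ℕ // m ≠ n} => hr m)))

/-- Coverage given the positions: the fading is averaged out. -/
lemma measure_covered_of_first (hγ : 0 < γ) {τ P : ℝ} (hP : 0 < P)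
    (hm : ∀ n, Measurable (h n)) (hlaw : ∀ n, μ.map (h n) = expMeasure 1) (hind : iIndepFun h μ)
    {x : ℕ → EuclideanSpace ℝ (Fin 2)} (hx : ∀ n, 0 < ‖x n‖ ^ 2) {n : ℕ}
    (hn : ∀ m, m ≠ n → ‖x n‖ ^ 2 < ‖x m‖ ^ 2) :
    μ {ω | (x, fun m => h m ω) ∈ coveredConfigs α γ τ P} =
      ENNReal.ofReal (Real.exp (-(γ * τ ^ 2 * P⁻¹ * (‖x n‖ ^ 2) ^ (α / 2)))) *
        expNeg (∑' m, logInterference γ (α / 2) (‖x n‖ ^ 2) (‖x m‖ ^ 2)) := by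
  have hx0 : ∀ m, 0 < ‖x m‖ := fun m =>
    lt_of_le_of_ne (norm_nonneg _) fun h0 => by simpa [← h0] using hx m
  have hsq : ∀ m, (‖x m‖ ^ 2) ^ (α / 2) = ‖x m‖ ^ α := fun m => by
    rw [← Real.rpow_natCast, ← Real.rpow_mul (norm_nonneg _)]
    congr 1; push_cast; ring
  set a : ℕ → ℝ := fun m => ‖x m‖ ^ (-α) with ha
  have ha0 : ∀ m, 0 < a m := fun m => Real.rpow_pos_of_pos (hx0 m) _
  have hainv : ∀ m, (a m)⁻¹ = ‖x m‖ ^ α := fun m => by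
    rw [ha]; simp only; rw [Real.rpow_neg (hx0 m).le, inv_inv]
  -- Interference weights relative to the serving link, including the threshold. Weight 0 at `n`
  -- lets the sum run over all indices.
  let c : ℕ → ℝ := fun m => if m = n then 0 else γ * a m * (a n)⁻¹
  have hc : ∀ m, 0 ≤ c m := fun m => by
    simp only [c]
    split_ifs
    · exact le_rfl
    · have := ha0 m; have := ha0 n; positivity
  have hcn : c n = 0 := by simp [c]
  have hb0 : 0 ≤ γ * τ ^ 2 * P⁻¹ * ‖x n‖ ^ α := by positivity
  have hset : {ω | (x, fun m => h m ω) ∈ coveredConfigs α γ τ P} =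
      {ω | ENNReal.ofReal (γ * τ ^ 2 * P⁻¹ * ‖x n‖ ^ α) + ∑' m, ENNReal.ofReal (h m ω * c m) <
        ENNReal.ofReal (h n ω)} := by
    ext ω
    have huniq : ∀ k, (∀ m, m ≠ k → ‖x k‖ < ‖x m‖) ↔ k = n := by
      have hn' : ∀ m, m ≠ n → ‖x n‖ < ‖x m‖ := fun m hmn =>
        lt_of_pow_lt_pow_left₀ 2 (norm_nonneg _) (hn m hmn)
      intro k
      refine ⟨fun hk => by_contra fun hkn => ?_, fun hk => hk ▸ hn'⟩
      exact lt_asymm (hn' k hkn) (hk n (Ne.symm hkn))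
    have e1 : (x, fun m => h m ω) ∈ coveredConfigs α γ τ P ↔
        ENNReal.ofReal γ < ENNReal.ofReal (P * h n ω * a n) /
          (ENNReal.ofReal (τ ^ 2) + ∑' m : {m : ℕ // m ≠ n}, ENNReal.ofReal (P * h m ω * a m)) := by
      simp only [coveredConfigs, mem_ofPred_eq, huniq, exists_eq_left]
      rfl
    have hγ' : ENNReal.ofReal γ ≠ 0 := by simpa using hγ
    -- Multiplying by 1/(P a_n) normalises the received signal to `h n`.
    set k := ENNReal.ofReal (P⁻¹ * (a n)⁻¹) with hk
    have hkpos : 0 < P⁻¹ * (a n)⁻¹ := mul_pos (inv_pos.2 hP) (inv_pos.2 (ha0 n))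
    have hk0 : k ≠ 0 := by simpa [hk] using hkpos
    have hkt : k ≠ ∞ := ENNReal.ofReal_ne_top
    have e2 : k * ENNReal.ofReal (P * h n ω * a n) = ENNReal.ofReal (h n ω) := by
      rw [hk, ← ENNReal.ofReal_mul hkpos.le]
      congr 1
      have := (ha0 n).ne'
      field_simp
    have e3 : k * (ENNReal.ofReal γ * (ENNReal.ofReal (τ ^ 2) +
        ∑' m : {m : ℕ // m ≠ n}, ENNReal.ofReal (P * h m ω * a m))) =
        ENNReal.ofReal (γ * τ ^ 2 * P⁻¹ * ‖x n‖ ^ α) + ∑' m, ENNReal.ofReal (h m ω * c m) := by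
      rw [mul_add, mul_add, ← ENNReal.ofReal_mul hγ.le, ← ENNReal.ofReal_mul hkpos.le,
        ← ENNReal.tsum_mul_left, ← ENNReal.tsum_mul_left, ← hainv]
      congr 1
      · congr 1; ring
      · refine (tsum_subtype {m : ℕ | m ≠ n}
          (fun m => k * (ENNReal.ofReal γ * ENNReal.ofReal (P * h m ω * a m)))).trans ?_
        refine tsum_congr fun m => ?_
        by_cases hmn : m = n
        · rw [indicator_of_notMem (by simpa using hmn), hmn, hcn]; simp
        · rw [indicator_of_mem (by simpa using hmn), hk, ← ENNReal.ofReal_mul hγ.le,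
            ← ENNReal.ofReal_mul hkpos.le]
          congr 1
          simp only [c, if_neg hmn]
          field_simp
    rw [mem_ofPred_eq, mem_ofPred_eq, e1,
      ENNReal.lt_div_iff_mul_lt (Or.inr ENNReal.ofReal_ne_top) (Or.inr hγ'),
      ← e2, ← e3]
    exact (ENNReal.mul_lt_mul_iff_right hk0 hkt).symm
  rw [hset, measure_noise_add_interference_lt hm hlaw hind n hc hcn, expNeg_add,
    expNeg_ofReal hb0, hsq]
  congr 2
  refine tsum_congr fun m => ?_
  rw [logInterference]
  by_cases hmn : m = n
  · rw [hmn, hcn, if_neg (lt_irrefl _)]; simp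
  · rw [if_pos (hn m hmn), Real.div_rpow (hx n).le (hx m).le, hsq, hsq, ← hainv, ← hainv]
    simp only [c, if_neg hmn]
    congr 3
    have := (ha0 n).ne'
    have := (ha0 m).ne'
    field_simp

/-- The coverage probability of the Poisson network. -/
theorem coverageProb_eq_covFormula (hL : 0 < L) (hγ : 0 < γ) (hα : 2 < α)
    (hN : IsRayleighPoissonNetwork μ L X h) {τ P : ℝ} (hP : 0 < P) :
    coverageProb μ X h α γ τ P = covFormula (γ ^ (-(2 / α))) α γ L τ P := by
  have hV := hN.ppp.isPoisson_norm_sq hL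
  have hl : 0 < Real.pi * L := mul_pos Real.pi_pos hL
  have hXm : Measurable fun ω n => X n ω := measurable_pi_lambda _ hN.ppp.measurable
  have hhm : Measurable fun ω n => h n ω := measurable_pi_lambda _ hN.measurable_fading
  have hS := measurableSet_coveredConfigs α γ τ P
  have hjoint := (indepFun_iff_map_prod_eq_prod_map_map hXm.aemeasurable hhm.aemeasurable).1 hN.indep
  -- Positions and fading are independent, so by Fubini the fading may be sampled from a separate
  -- copy ω' with the positions held fixed.
  have h1 : μ {ω | ∃ n, (∀ m, m ≠ n → ‖X n ω‖ < ‖X m ω‖) ∧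
      ENNReal.ofReal γ < sinr X h α τ P n ω} =
      ∫⁻ ω, μ {ω' | (fun n => X n ω, fun n => h n ω') ∈ coveredConfigs α γ τ P} ∂μ := by
    have e1 : {ω | ∃ n, (∀ m, m ≠ n → ‖X n ω‖ < ‖X m ω‖) ∧
        ENNReal.ofReal γ < sinr X h α τ P n ω} =
        (fun ω => ((fun n => X n ω), (fun n => h n ω))) ⁻¹' coveredConfigs α γ τ P := rfl
    rw [e1, ← Measure.map_apply (hXm.prodMk hhm) hS, hjoint, Measure.prod_apply hS,
      lintegral_map (measurable_measure_prodMk_left hS) hXm]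
    refine lintegral_congr fun ω => ?_
    rw [Measure.map_apply hhm (measurable_prodMk_left hS)]
    rfl
  have h2 : ∀ᵐ ω ∂μ, μ {ω' | (fun n => X n ω, fun n => h n ω') ∈ coveredConfigs α γ τ P} =
      ENNReal.ofReal (Real.exp (-(γ * τ ^ 2 * P⁻¹ * (⨅ n, ‖X n ω‖ ^ 2) ^ (α / 2)))) *
        expNeg (∑' n, logInterference γ (α / 2) (⨅ n, ‖X n ω‖ ^ 2) (‖X n ω‖ ^ 2)) := by
    filter_upwards [ae_exists_first hl.le hV] with ω ⟨hp, n, hn, hlt⟩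
    rw [hn]
    exact measure_covered_of_first hγ hP hN.measurable_fading hN.fading_law
      hN.fading_indep hp hlt
  have hc : 0 ≤ γ * τ ^ 2 * P⁻¹ := by positivity
  rw [coverageProb, measureReal_def, h1, lintegral_congr_ae h2,
    lintegral_expNeg_first_logInterference hl hγ hα hc hV, ENNReal.toReal_ofReal, covFormula]
  · congr 1
    refine integral_congr_ae (ae_of_all _ fun v => ?_)
    simp only
    congr 2; ring
  · exact mul_nonneg hl.le (integral_nonneg fun v => Real.exp_nonneg _)

end Coverage

/-! ### The low-noise expansion of the coverage formula -/

section Expansion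

variable {b s β : ℝ}

lemma integrableOn_exp_neg_mul_rpow {q : ℝ} (hb : 0 < b) (hq : 0 ≤ q) :
    IntegrableOn (fun v : ℝ => Real.exp (-(b * v)) * v ^ q) (Ioi 0) := by
  have := integrableOn_rpow_mul_exp_neg_mul_rpow (s := q) (p := 1) (b := b) (by linarith) one_pos hb
  refine this.congr_fun (fun v _ => ?_) measurableSet_Ioi
  simp only [Real.rpow_one, neg_mul]
  ring

lemma integral_exp_neg_mul_rpow {q : ℝ} (hb : 0 < b) (hq : 0 ≤ q) :
    ∫ v in Ioi (0 : ℝ), Real.exp (-(b * v)) * v ^ q = b⁻¹ * (Real.Gamma (q + 1) / b ^ q) := by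
  have h := Real.integral_rpow_mul_exp_neg_mul_Ioi (a := q + 1) (by linarith) hb
  rw [add_sub_cancel_right] at h
  simp_rw [mul_comm (Real.exp _)]
  rw [h, one_div, Real.inv_rpow hb.le, Real.rpow_add_one hb.ne']
  have := (Real.rpow_pos_of_pos hb q).ne'
  field_simp

/-- From 1 + x + x²/2 ≤ e^x and (1 - x + x²/2)(1 + x + x²/2) = 1 + x⁴/4 ≥ 1. -/
lemma exp_neg_le_quadratic {x : ℝ} (hx : 0 ≤ x) : Real.exp (-x) ≤ 1 - x + x ^ 2 / 2 := by
  have h := Real.quadratic_le_exp_of_nonneg hx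
  rw [Real.exp_neg, inv_le_iff_one_le_mul₀ (Real.exp_pos x)]
  have h2 : 0 ≤ 1 - x + x ^ 2 / 2 := by nlinarith [sq_nonneg (x - 1)]
  nlinarith [mul_le_mul_of_nonneg_left h h2, sq_nonneg (x ^ 2)]

lemma integral_exp_neg_sub_rpow_zero (hb : 0 < b) :
    ∫ v in Ioi (0 : ℝ), Real.exp (-(b * v)) = b⁻¹ := by
  have := integral_exp_neg_mul_rpow (q := 0) hb le_rfl
  simpa using this

lemma integrableOn_exp_neg_mul_one_sub (hb : 0 < b) (hβ : 0 ≤ β) :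
    IntegrableOn (fun v : ℝ => Real.exp (-(b * v)) * (1 - s * v ^ β)) (Ioi 0) := by
  have h0 := integrableOn_exp_neg_mul_rpow (q := 0) hb le_rfl
  have h1 := (integrableOn_exp_neg_mul_rpow (q := β) hb hβ).const_mul s
  refine (h0.sub h1).congr_fun (fun v _ => ?_) measurableSet_Ioi
  simp only [Real.rpow_zero, Pi.sub_apply]
  ring

lemma integral_exp_neg_mul_one_sub (hb : 0 < b) (hβ : 0 ≤ β) :
    ∫ v in Ioi (0 : ℝ), Real.exp (-(b * v)) * (1 - s * v ^ β) =
      b⁻¹ * (1 - s * (Real.Gamma (β + 1) / b ^ β)) := by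
  have h0 := integrableOn_exp_neg_mul_rpow (q := 0) hb le_rfl
  have h1 := (integrableOn_exp_neg_mul_rpow (q := β) hb hβ).const_mul s
  have e : ∀ v : ℝ, Real.exp (-(b * v)) * (1 - s * v ^ β) =
      Real.exp (-(b * v)) * v ^ (0 : ℝ) - s * (Real.exp (-(b * v)) * v ^ β) := fun v => by
    rw [Real.rpow_zero]; ring
  simp_rw [e]
  rw [integral_sub h0 h1, integral_const_mul, integral_exp_neg_mul_rpow hb le_rfl,
    integral_exp_neg_mul_rpow hb hβ]
  simp only [zero_add, Real.Gamma_one, Real.rpow_zero]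
  ring

lemma integral_exp_neg_sub_rpow_bounds (hb : 0 < b) (hs : 0 ≤ s) (hβ : 0 ≤ β) :
    0 ≤ (∫ v in Ioi (0 : ℝ), Real.exp (-(b * v) - s * v ^ β)) -
        ∫ v in Ioi (0 : ℝ), Real.exp (-(b * v)) * (1 - s * v ^ β) ∧
      (∫ v in Ioi (0 : ℝ), Real.exp (-(b * v) - s * v ^ β)) -
        ∫ v in Ioi (0 : ℝ), Real.exp (-(b * v)) * (1 - s * v ^ β) ≤
      b⁻¹ * (s ^ 2 * Real.Gamma (2 * β + 1) / (2 * b ^ (2 * β))) := by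
  have i1 := integrableOn_exp_neg_sub_rpow (β := β) hb hs
  have i2 := integrableOn_exp_neg_mul_one_sub (s := s) hb hβ
  have i3 := (integrableOn_exp_neg_mul_rpow (q := 2 * β) hb (by linarith)).const_mul (s ^ 2 / 2)
  have e : b⁻¹ * (s ^ 2 * Real.Gamma (2 * β + 1) / (2 * b ^ (2 * β))) =
      ∫ v in Ioi (0 : ℝ), s ^ 2 / 2 * (Real.exp (-(b * v)) * v ^ (2 * β)) := by
    rw [integral_const_mul, integral_exp_neg_mul_rpow hb (by linarith)]
    have := (Real.rpow_pos_of_pos hb (2 * β)).ne'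
    field_simp
  rw [← integral_sub i1 i2, e]
  refine ⟨setIntegral_nonneg measurableSet_Ioi fun v _ => ?_,
    setIntegral_mono_on (i1.sub i2) i3 measurableSet_Ioi fun v hv => ?_⟩
  · have := Real.one_sub_le_exp_neg (s * v ^ β)
    rw [sub_eq_add_neg (-(b * v)), Real.exp_add, ← mul_sub]
    exact mul_nonneg (Real.exp_nonneg _) (by linarith)
  · have hv0 : 0 ≤ v := le_of_lt hv
    have h := exp_neg_le_quadratic (mul_nonneg hs (Real.rpow_nonneg hv0 β))
    have h2 : v ^ (2 * β) = (v ^ β) ^ 2 := by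
      rw [← Real.rpow_natCast, ← Real.rpow_mul hv0]; congr 1; push_cast; ring
    have h3 := mul_le_mul_of_nonneg_left h (Real.exp_nonneg (-(b * v)))
    rw [sub_eq_add_neg (-(b * v)), Real.exp_add, h2]
    nlinarith

lemma integral_exp_neg_sub_rpow_anti {s' : ℝ} (hb : 0 < b) (hs : 0 ≤ s) (hss : s ≤ s') :
    ∫ v in Ioi (0 : ℝ), Real.exp (-(b * v) - s' * v ^ β) ≤
      ∫ v in Ioi (0 : ℝ), Real.exp (-(b * v) - s * v ^ β) := by
  refine setIntegral_mono_on (integrableOn_exp_neg_sub_rpow hb (hs.trans hss))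
    (integrableOn_exp_neg_sub_rpow hb hs) measurableSet_Ioi fun v hv => ?_
  have := mul_le_mul_of_nonneg_right hss (Real.rpow_nonneg (le_of_lt hv) β)
  exact Real.exp_le_exp.2 (by linarith)

/-- The limit `g` is left free to serve both continuity in the power and the limit at zero power,
where `g` is 0. -/
lemma tendsto_integral_exp_neg_sub_rpow {ι : Type*} {l : Filter ι} [l.IsCountablyGenerated]
    {f : ι → ℝ} {g : ℝ → ℝ} (hb : 0 < b) (hf : ∀ᶠ i in l, 0 ≤ f i)
    (h : ∀ v : ℝ, 0 < v → Tendsto (fun i => Real.exp (-(b * v) - f i * v ^ β)) l (𝓝 (g v))) :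
    Tendsto (fun i => ∫ v in Ioi (0 : ℝ), Real.exp (-(b * v) - f i * v ^ β)) l
      (𝓝 (∫ v in Ioi (0 : ℝ), g v)) := by
  refine tendsto_integral_filter_of_dominated_convergence (fun v => Real.exp (-(b * v)))
    (Eventually.of_forall fun i => Measurable.aestronglyMeasurable (by fun_prop)) ?_ ?_ ?_
  · filter_upwards [hf] with i hi
    filter_upwards [ae_restrict_mem measurableSet_Ioi] with v hv
    rw [Real.norm_of_nonneg (Real.exp_nonneg _)]
    have := mul_nonneg hi (Real.rpow_nonneg (le_of_lt hv) β)
    exact Real.exp_le_exp.2 (by linarith)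
  · simpa [IntegrableOn] using integrableOn_exp_neg_mul_rpow (q := 0) hb le_rfl
  · filter_upwards [ae_restrict_mem measurableSet_Ioi] with v hv
    exact h v hv

end Expansion

/-! ### Minimum powers from a low-noise expansion -/

section MinPower

variable {F : ℝ → ℝ} {C c d : ℝ}

/-- At this power the lower bound C(1 - c/P) equals εC exactly. -/
lemma div_one_sub_feasible (hC : 0 < C) (hc : 0 < c)
    (hlow : ∀ P, 0 < P → C * (1 - c / P) ≤ F P) {ε : ℝ} (hε1 : ε < 1) :
    c / (1 - ε) ∈ {P : ℝ | 0 < P ∧ ε * C ≤ F P} := by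
  have h1 : 0 < 1 - ε := by linarith
  have hP : 0 < c / (1 - ε) := div_pos hc h1
  refine ⟨hP, le_trans (le_of_eq ?_) (hlow _ hP)⟩
  have := h1.ne'
  have := hc.ne'
  field_simp
  ring

/-- As F tends to 0 at 0, feasible powers stay above some δ > 0; the feasible set is therefore
closed in ℝ although the domain `(0, ∞)` is not. -/
lemma isLeast_sInf_feasible (hC : 0 < C) (hcont : ContinuousOn F (Ioi 0))
    (hzero : Tendsto F (𝓝[>] 0) (𝓝 0)) {ε : ℝ} (hε : 0 < ε)
    (hne : {P : ℝ | 0 < P ∧ ε * C ≤ F P}.Nonempty) :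
    IsLeast {P : ℝ | 0 < P ∧ ε * C ≤ F P} (sInf {P : ℝ | 0 < P ∧ ε * C ≤ F P}) := by
  set S := {P : ℝ | 0 < P ∧ ε * C ≤ F P} with hS
  obtain ⟨δ, hδ, hδS⟩ := mem_nhdsGT_iff_exists_Ioo_subset.1
    (hzero.eventually (gt_mem_nhds (mul_pos hε hC)))
  have hδ0 : 0 < δ := hδ
  have hge : ∀ P ∈ S, δ ≤ P := fun P hP => by
    by_contra hlt
    exact absurd (show F P < ε * C from hδS ⟨hP.1, not_le.1 hlt⟩) (not_lt.2 hP.2)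
  have hclosed : IsClosed S := by
    have : S = Ici δ ∩ F ⁻¹' Ici (ε * C) := by
      ext P
      exact ⟨fun hP => ⟨hge P hP, hP.2⟩, fun hP => ⟨hδ0.trans_le hP.1, hP.2⟩⟩
    rw [this]
    exact (hcont.mono fun x hx => hδ0.trans_le hx).preimage_isClosed_of_isClosed isClosed_Ici
      isClosed_Ici
  have hbdd : BddBelow S := ⟨δ, hge⟩
  exact ⟨hclosed.csInf_mem hne hbdd, fun P hP => csInf_le hbdd hP⟩

/-- The minimum p satisfies c/p ≤ (1 - ε) + d/p². This inequality also admits small p, which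
monotonicity excludes; for p > c/(4(1 - ε)) it gives a ratio of at least 1 - 4d(1 - ε)/c². -/
lemma tendsto_sInf_feasible (hC : 0 < C) (hc : 0 < c) (hd : 0 < d)
    (hlow : ∀ P, 0 < P → C * (1 - c / P) ≤ F P)
    (hup : ∀ P, 0 < P → F P ≤ C * (1 - c / P + d / P ^ 2))
    (hmono : ∀ P Q, 0 < P → P ≤ Q → F P ≤ F Q) (hcont : ContinuousOn F (Ioi 0))
    (hzero : Tendsto F (𝓝[>] 0) (𝓝 0)) :
    Tendsto (fun ε : ℝ => sInf {P : ℝ | 0 < P ∧ ε * C ≤ F P} / (c / (1 - ε))) (𝓝[<] 1) (𝓝 1) := by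
  have hlower : Tendsto (fun ε : ℝ => 1 - 4 * d * (1 - ε) / c ^ 2) (𝓝[<] 1) (𝓝 1) := by
    have : Tendsto (fun ε : ℝ => 1 - 4 * d * (1 - ε) / c ^ 2) (𝓝 1)
        (𝓝 (1 - 4 * d * (1 - 1) / c ^ 2)) := Continuous.tendsto (by fun_prop) 1
    simp only [sub_self, mul_zero, zero_div, sub_zero] at this
    exact this.mono_left nhdsWithin_le_nhds
  have hδ : 0 < min 1 (c ^ 2 / (8 * d)) := lt_min one_pos (by positivity)
  have hev : ∀ᶠ ε in 𝓝[<] (1 : ℝ), ε < 1 ∧ 1 - min 1 (c ^ 2 / (8 * d)) < ε := by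
    refine eventually_nhdsWithin_iff.2 ?_
    filter_upwards [lt_mem_nhds (show 1 - min 1 (c ^ 2 / (8 * d)) < 1 by linarith)] with ε h1 h2
    exact ⟨h2, h1⟩
  refine tendsto_of_tendsto_of_tendsto_of_le_of_le' hlower tendsto_const_nhds ?_ ?_
  · filter_upwards [hev] with ε ⟨h1, h2⟩
    have hη : 0 < 1 - ε := by linarith
    have hε : 0 < ε := by linarith [min_le_left 1 (c ^ 2 / (8 * d))]
    have hη8 : (1 - ε) * (8 * d) ≤ c ^ 2 := by
      rw [← le_div_iff₀ (by positivity)]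
      linarith [min_le_right 1 (c ^ 2 / (8 * d))]
    obtain ⟨⟨hp, hpF⟩, -⟩ := isLeast_sInf_feasible hC hcont hzero hε
      ⟨_, div_one_sub_feasible hC hc hlow h1⟩
    set p := sInf {P : ℝ | 0 < P ∧ ε * C ≤ F P} with hpdef
    have key : ∀ Q, 0 < Q → ε * C ≤ F Q → c / Q ≤ 1 - ε + d / Q ^ 2 := by
      intro Q hQ hQF
      have : ε ≤ 1 - c / Q + d / Q ^ 2 :=
        le_of_mul_le_mul_left (by linarith [hup Q hQ]) hC
      linarith
    -- Otherwise Q = c/(4η), with η = 1 - ε, would be feasible by monotonicity. As 8dη ≤ c², d/Q² ≤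
    -- 2η, so `key` would give 4η ≤ 3η.
    have hbig : c / (4 * (1 - ε)) < p := by
      by_contra hle
      have hQ : 0 < c / (4 * (1 - ε)) := by positivity
      have h3 := key _ hQ (hpF.trans (hmono _ _ hp (not_lt.1 hle)))
      have e1 : c / (c / (4 * (1 - ε))) = 4 * (1 - ε) := by field_simp
      have e2 : d / (c / (4 * (1 - ε))) ^ 2 = 2 * (1 - ε) * ((1 - ε) * (8 * d)) / c ^ 2 := by
        field_simp; ring
      have e3 : 2 * (1 - ε) * ((1 - ε) * (8 * d)) / c ^ 2 ≤ 2 * (1 - ε) := by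
        rw [div_le_iff₀ (by positivity)]
        exact mul_le_mul_of_nonneg_left hη8 (by linarith)
      rw [e1, e2] at h3
      linarith
    have h4 := key p hp hpF
    have h5 : c ≤ (1 - ε) * p + d / p := by
      have := mul_le_mul_of_nonneg_right h4 hp.le
      have e1 : c / p * p = c := by field_simp
      have e2 : (1 - ε + d / p ^ 2) * p = (1 - ε) * p + d / p := by field_simp
      rwa [e1, e2] at this
    have h6 : d / p ≤ 4 * d * (1 - ε) / c := by
      rw [div_lt_iff₀ (by positivity)] at hbig
      rw [div_le_div_iff₀ hp hc]
      nlinarith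
    have e : p / (c / (1 - ε)) = (1 - ε) * p / c := by field_simp
    rw [e, le_div_iff₀ hc]
    have e' : (1 - 4 * d * (1 - ε) / c ^ 2) * c = c - 4 * d * (1 - ε) / c := by field_simp
    rw [e']
    linarith
  · filter_upwards [hev] with ε ⟨h1, h2⟩
    have hη : 0 < 1 - ε := by linarith
    rw [div_le_one (by positivity)]
    exact csInf_le ⟨0, fun P hP => hP.1.le⟩ (div_one_sub_feasible hC hc hlow h1)

end MinPower

/-! ### The coverage formula -/

section Formula

variable {κ α γ L σ : ℝ}

/-- The coefficient of `1 / P` in the low-noise expansion. -/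
def lowNoiseCoeff (κ α γ L σ : ℝ) : ℝ :=
  γ * σ ^ 2 * Real.Gamma (α / 2 + 1) / (Real.pi * L * (1 + upsilon κ γ α)) ^ (α / 2)

lemma covFormula_eq (κ α γ L σ P : ℝ) :
    covFormula κ α γ L σ P = Real.pi * L * ∫ v in Ioi (0 : ℝ),
      Real.exp (-(Real.pi * L * (1 + upsilon κ γ α) * v) - γ * σ ^ 2 * P⁻¹ * v ^ (α / 2)) := by
  rw [covFormula]
  simp_rw [mul_right_comm _ (_ ^ (α / 2)) P⁻¹]

lemma rate_pos (hκ : 0 ≤ κ) (hγ : 0 < γ) (hL : 0 < L) :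
    0 < Real.pi * L * (1 + upsilon κ γ α) := by
  have := upsilon_nonneg (α := α) hκ hγ
  have := Real.pi_pos
  positivity

lemma pi_mul_inv_rate (hκ : 0 ≤ κ) (hγ : 0 < γ) (hL : 0 < L) :
    Real.pi * L * (Real.pi * L * (1 + upsilon κ γ α))⁻¹ = (1 + upsilon κ γ α)⁻¹ := by
  have := upsilon_nonneg (α := α) hκ hγ
  have := Real.pi_pos
  field_simp

lemma covFormula_noiseless (hκ : 0 ≤ κ) (hγ : 0 < γ) (hL : 0 < L) (P : ℝ) :
    covFormula κ α γ L 0 P = (1 + upsilon κ γ α)⁻¹ := by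
  rw [covFormula_eq, ← pi_mul_inv_rate hκ hγ hL,
    ← integral_exp_neg_sub_rpow_zero (rate_pos (α := α) hκ hγ hL)]
  simp

lemma covLinear_eq (hκ : 0 ≤ κ) (hα : 0 < α) (hγ : 0 < γ) (hL : 0 < L) (σ P : ℝ) :
    covLinear κ α γ L σ P = (1 + upsilon κ γ α)⁻¹ * (1 - lowNoiseCoeff κ α γ L σ / P) := by
  rw [covLinear, integral_exp_neg_mul_one_sub (rate_pos hκ hγ hL) (by linarith), ← mul_assoc,
    pi_mul_inv_rate hκ hγ hL, lowNoiseCoeff]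
  congr 2
  rw [div_eq_mul_inv _ P]
  ring

lemma covFormula_sub_covLinear (hκ : 0 ≤ κ) (hα : 0 < α) (hγ : 0 < γ) (hL : 0 < L) (σ : ℝ) {P : ℝ}
    (hP : 0 < P) :
    0 ≤ covFormula κ α γ L σ P - covLinear κ α γ L σ P ∧
      covFormula κ α γ L σ P - covLinear κ α γ L σ P ≤ (1 + upsilon κ γ α)⁻¹ *
        ((γ * σ ^ 2 / P) ^ 2 * Real.Gamma (α + 1) /
          (2 * (Real.pi * L * (1 + upsilon κ γ α)) ^ α)) := by
  have hs : 0 ≤ γ * σ ^ 2 * P⁻¹ := by positivity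
  have h := integral_exp_neg_sub_rpow_bounds (β := α / 2) (rate_pos (α := α) hκ hγ hL) hs
    (by linarith)
  rw [mul_div_cancel₀ α two_ne_zero] at h
  have hpL : 0 < Real.pi * L := mul_pos Real.pi_pos hL
  rw [covFormula_eq, covLinear, ← mul_sub, ← pi_mul_inv_rate hκ hγ hL,
    mul_assoc (Real.pi * L) (Real.pi * L * (1 + upsilon κ γ α))⁻¹,
    div_eq_mul_inv (γ * σ ^ 2) P]
  exact ⟨mul_nonneg hpL.le h.1, mul_le_mul_of_nonneg_left h.2 hpL.le⟩

lemma covFormula_mono (hκ : 0 ≤ κ) (hγ : 0 < γ) (hL : 0 < L) (σ : ℝ) {P Q : ℝ} (hP : 0 < P)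
    (hPQ : P ≤ Q) : covFormula κ α γ L σ P ≤ covFormula κ α γ L σ Q := by
  rw [covFormula_eq, covFormula_eq]
  have hQ := hP.trans_le hPQ
  refine mul_le_mul_of_nonneg_left (integral_exp_neg_sub_rpow_anti (rate_pos hκ hγ hL)
    (by positivity) ?_) (mul_pos Real.pi_pos hL).le
  exact mul_le_mul_of_nonneg_left (inv_anti₀ hP hPQ) (by positivity)

lemma continuousOn_covFormula (hκ : 0 ≤ κ) (hγ : 0 < γ) (hL : 0 < L) (σ : ℝ) :
    ContinuousOn (covFormula κ α γ L σ) (Ioi 0) := by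
  intro P hP
  have hP0 : P ≠ 0 := ne_of_gt hP
  refine ContinuousAt.continuousWithinAt ?_
  have e : covFormula κ α γ L σ = fun P => Real.pi * L * ∫ v in Ioi (0 : ℝ),
      Real.exp (-(Real.pi * L * (1 + upsilon κ γ α) * v) - γ * σ ^ 2 * P⁻¹ * v ^ (α / 2)) :=
    funext (covFormula_eq κ α γ L σ)
  rw [e]
  refine Tendsto.const_mul _ (tendsto_integral_exp_neg_sub_rpow (f := fun P => γ * σ ^ 2 * P⁻¹)
    (rate_pos hκ hγ hL) ?_ fun v _ => ?_)
  · filter_upwards [lt_mem_nhds (show 0 < P from hP)] with Q hQ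
    positivity
  · have hinv := tendsto_inv₀ hP0
    exact (Real.continuous_exp.tendsto _).comp
      (((hinv.const_mul (γ * σ ^ 2)).mul_const (v ^ (α / 2))).const_sub _)

/-- For σ > 0 the exponent tends to -∞ at each v > 0, so the integrand vanishes in the limit. -/
lemma tendsto_covFormula_zero (hκ : 0 ≤ κ) (hγ : 0 < γ) (hL : 0 < L) (hσ : 0 < σ) :
    Tendsto (covFormula κ α γ L σ) (𝓝[>] 0) (𝓝 0) := by
  have e : covFormula κ α γ L σ = fun P => Real.pi * L * ∫ v in Ioi (0 : ℝ),
      Real.exp (-(Real.pi * L * (1 + upsilon κ γ α) * v) - γ * σ ^ 2 * P⁻¹ * v ^ (α / 2)) :=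
    funext (covFormula_eq κ α γ L σ)
  have h := tendsto_integral_exp_neg_sub_rpow (l := 𝓝[>] (0 : ℝ)) (β := α / 2) (g := fun _ => 0)
    (f := fun P => γ * σ ^ 2 * P⁻¹) (rate_pos (α := α) hκ hγ hL) ?_ fun v hv => ?_
  · rw [e]
    simpa using h.const_mul (Real.pi * L)
  · filter_upwards [self_mem_nhdsWithin] with Q hQ
    have : (0 : ℝ) < Q := hQ
    positivity
  · refine Real.tendsto_exp_atBot.comp ?_
    have h1 : Tendsto (fun P : ℝ => γ * σ ^ 2 * P⁻¹ * v ^ (α / 2)) (𝓝[>] 0) atTop :=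
      (tendsto_inv_nhdsGT_zero.const_mul_atTop (by positivity)).atTop_mul_const
        (Real.rpow_pos_of_pos hv _)
    exact tendsto_atBot_add_const_left _ _ (tendsto_neg_atTop_atBot.comp h1)

lemma lowNoiseCoeff_pos (hκ : 0 ≤ κ) (hα : 0 < α) (hγ : 0 < γ) (hL : 0 < L) (hσ : 0 < σ) :
    0 < lowNoiseCoeff κ α γ L σ := by
  have h1 := Real.Gamma_pos_of_pos (show 0 < α / 2 + 1 by linarith)
  have h2 := Real.rpow_pos_of_pos (rate_pos (α := α) hκ hγ hL) (α / 2)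
  unfold lowNoiseCoeff
  positivity

lemma optPower_eq (hκ : 0 ≤ κ) (hγ : 0 < γ) (hL : 0 < L) (σ ε : ℝ) :
    optPower κ α γ σ L ε = lowNoiseCoeff κ α γ L σ / (1 - ε) := by
  have hU := upsilon_nonneg (α := α) hκ hγ
  have hpi := Real.pi_pos
  rw [optPower, L1, lowNoiseCoeff, Real.mul_rpow (mul_pos hpi hL).le (by linarith),
    Real.mul_rpow hpi.le hL.le, div_div, div_div]
  congr 1
  ring

lemma feasiblePowers_covFormula (hκ : 0 ≤ κ) (hγ : 0 < γ) (hL : 0 < L) (σ ε : ℝ) :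
    feasiblePowers (covFormula κ α γ L) σ ε =
      {P : ℝ | 0 < P ∧ ε * (1 + upsilon κ γ α)⁻¹ ≤ covFormula κ α γ L σ P} := by
  simp only [feasiblePowers, covFormula_noiseless hκ hγ hL]

/-- After cancelling the noiseless coverage, the constraint reads ε ≤ 1 - c/P, that is P ≥ c/(1 -
ε). -/
lemma isLeast_optPower_covLinear (hκ : 0 ≤ κ) (hα : 0 < α) (hγ : 0 < γ) (hL : 0 < L) (hσ : 0 < σ)
    {ε : ℝ} (hε1 : ε < 1) :
    IsLeast (feasiblePowers (covLinear κ α γ L) σ ε) (optPower κ α γ σ L ε) := by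
  have hC : 0 < (1 + upsilon κ γ α)⁻¹ := by
    have := upsilon_nonneg (α := α) hκ hγ
    positivity
  have hc := lowNoiseCoeff_pos hκ hα hγ hL hσ
  have h1 : 0 < 1 - ε := by linarith
  have hmem : ∀ P, P ∈ feasiblePowers (covLinear κ α γ L) σ ε ↔
      0 < P ∧ lowNoiseCoeff κ α γ L σ / (1 - ε) ≤ P := by
    intro P
    have h0 : lowNoiseCoeff κ α γ L 0 = 0 := by simp [lowNoiseCoeff]
    simp only [feasiblePowers, mem_ofPred_eq, covLinear_eq hκ hα hγ hL, h0]
    refine and_congr_right fun hP => ?_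
    rw [zero_div, sub_zero, mul_one, mul_comm ε, mul_le_mul_iff_right₀ hC, le_sub_comm,
      div_le_iff₀ hP, div_le_iff₀ h1, mul_comm P]
  rw [optPower_eq hκ hγ hL]
  exact ⟨(hmem _).2 ⟨div_pos hc h1, le_rfl⟩, fun P hP => ((hmem P).1 hP).2⟩

lemma covLinear_le_covFormula (hκ : 0 ≤ κ) (hα : 0 < α) (hγ : 0 < γ) (hL : 0 < L) (σ : ℝ) {P : ℝ}
    (hP : 0 < P) :
    (1 + upsilon κ γ α)⁻¹ * (1 - lowNoiseCoeff κ α γ L σ / P) ≤ covFormula κ α γ L σ P := by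
  rw [← covLinear_eq hκ hα hγ hL]
  linarith [(covFormula_sub_covLinear hκ hα hγ hL σ hP).1]

lemma isLeast_sInf_covFormula (hκ : 0 ≤ κ) (hα : 0 < α) (hγ : 0 < γ) (hL : 0 < L) (hσ : 0 < σ)
    {ε : ℝ} (hε : 0 < ε) (hε1 : ε < 1) :
    optPower κ α γ σ L ε ∈ feasiblePowers (covFormula κ α γ L) σ ε ∧
      IsLeast (feasiblePowers (covFormula κ α γ L) σ ε)
        (sInf (feasiblePowers (covFormula κ α γ L) σ ε)) := by
  have hC : 0 < (1 + upsilon κ γ α)⁻¹ := by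
    have := upsilon_nonneg (α := α) hκ hγ
    positivity
  rw [feasiblePowers_covFormula hκ hγ hL, optPower_eq hκ hγ hL]
  have hmem := div_one_sub_feasible hC (lowNoiseCoeff_pos hκ hα hγ hL hσ)
    (fun P hP => covLinear_le_covFormula hκ hα hγ hL σ hP) hε1
  exact ⟨hmem, isLeast_sInf_feasible hC (continuousOn_covFormula hκ hγ hL σ)
    (tendsto_covFormula_zero hκ hγ hL hσ) hε ⟨_, hmem⟩⟩

lemma tendsto_sInf_div_optPower (hκ : 0 ≤ κ) (hα : 0 < α) (hγ : 0 < γ) (hL : 0 < L) (hσ : 0 < σ) :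
    Tendsto (fun ε : ℝ => sInf (feasiblePowers (covFormula κ α γ L) σ ε) /
      optPower κ α γ σ L ε) (𝓝[<] 1) (𝓝 1) := by
  have hC : 0 < (1 + upsilon κ γ α)⁻¹ := by
    have := upsilon_nonneg (α := α) hκ hγ
    positivity
  simp_rw [feasiblePowers_covFormula hκ hγ hL, optPower_eq hκ hγ hL]
  have hd : 0 < (γ * σ ^ 2) ^ 2 * Real.Gamma (α + 1) /
      (2 * (Real.pi * L * (1 + upsilon κ γ α)) ^ α) := by
    have h1 := Real.Gamma_pos_of_pos (show 0 < α + 1 by linarith)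
    have h2 := Real.rpow_pos_of_pos (rate_pos (α := α) hκ hγ hL) α
    positivity
  refine tendsto_sInf_feasible hC (lowNoiseCoeff_pos hκ hα hγ hL hσ) hd
    (fun P hP => covLinear_le_covFormula hκ hα hγ hL σ hP) (fun P hP => ?_)
    (fun P Q hP hPQ => covFormula_mono hκ hγ hL σ hP hPQ) (continuousOn_covFormula hκ hγ hL σ)
    (tendsto_covFormula_zero hκ hγ hL hσ)
  have h := (covFormula_sub_covLinear hκ hα hγ hL σ hP).2
  rw [covLinear_eq hκ hα hγ hL] at h
  rw [mul_add]
  refine (sub_le_iff_le_add'.1 h).trans (le_of_eq ?_)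
  congr 2
  rw [div_pow]
  ring

end Formula

end ElasticNet

end

/-! ### Assembly of the formula and network statements -/

theorem lemma2 (α γ σ μa lr : ℝ) (hα : 2 < α) (hγ : 0 < γ) (hσ : 0 < σ)
    (hμa : 0 < μa) (hμa1 : μa ≤ 1) (hlr : 0 < lr) :
    -- the coverage formula, for every lower limit `κ` of the integral in Upsilon (`κ = 0` included)
    (∀ κ : ℝ, 0 ≤ κ →
      -- the formula without noise, and its first-order low-noise approximation
      (∀ P : ℝ, 0 < P →
        ElasticNet.covFormula κ α γ (μa * lr) 0 P = (1 + ElasticNet.upsilon κ γ α)⁻¹ ∧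
        ElasticNet.covLinear κ α γ (μa * lr) σ P =
          (1 + ElasticNet.upsilon κ γ α)⁻¹ *
            (1 - γ * σ ^ 2 * Real.Gamma (α / 2 + 1) /
              (P * (Real.pi * (μa * lr) * (1 + ElasticNet.upsilon κ γ α)) ^ (α / 2))) ∧
        0 ≤ ElasticNet.covFormula κ α γ (μa * lr) σ P -
          ElasticNet.covLinear κ α γ (μa * lr) σ P ∧
        ElasticNet.covFormula κ α γ (μa * lr) σ P -
            ElasticNet.covLinear κ α γ (μa * lr) σ P ≤
          (1 + ElasticNet.upsilon κ γ α)⁻¹ *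
            ((γ * σ ^ 2 / P) ^ 2 * Real.Gamma (α + 1) /
              (2 * (Real.pi * (μa * lr) * (1 + ElasticNet.upsilon κ γ α)) ^ α))) ∧
      -- the minimum power under the approximated constraint
      (∀ ε : ℝ, 0 ≤ ε → ε < 1 →
        IsLeast (ElasticNet.feasiblePowers (ElasticNet.covLinear κ α γ (μa * lr)) σ ε)
          (ElasticNet.optPower κ α γ σ (μa * lr) ε)) ∧
      -- the minimum power under the exact constraint
      (∀ ε : ℝ, 0 < ε → ε < 1 →
        ElasticNet.optPower κ α γ σ (μa * lr) ε ∈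
          ElasticNet.feasiblePowers (ElasticNet.covFormula κ α γ (μa * lr)) σ ε ∧
        IsLeast (ElasticNet.feasiblePowers (ElasticNet.covFormula κ α γ (μa * lr)) σ ε)
          (sInf (ElasticNet.feasiblePowers (ElasticNet.covFormula κ α γ (μa * lr)) σ ε))) ∧
      Tendsto
        (fun ε : ℝ =>
          sInf (ElasticNet.feasiblePowers (ElasticNet.covFormula κ α γ (μa * lr)) σ ε) /
            ElasticNet.optPower κ α γ σ (μa * lr) ε)
        (𝓝[<] 1) (𝓝 1)) ∧
    -- the coverage probability of the Poisson network
    (∀ (Ω : Type*) [MeasurableSpace Ω] (μ : Measure Ω) [IsProbabilityMeasure μ]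
        (X : ℕ → Ω → EuclideanSpace ℝ (Fin 2)) (h : ℕ → Ω → ℝ),
      ElasticNet.IsRayleighPoissonNetwork μ (μa * lr) X h →
      (∀ τ P : ℝ, 0 ≤ τ → 0 < P →
        ElasticNet.coverageProb μ X h α γ τ P =
          ElasticNet.covFormula (γ ^ (-(2 / α))) α γ (μa * lr) τ P) ∧
      (∀ ε : ℝ, 0 < ε → ε < 1 →
        ElasticNet.optPower (γ ^ (-(2 / α))) α γ σ (μa * lr) ε ∈
          ElasticNet.feasiblePowers (ElasticNet.coverageProb μ X h α γ) σ ε ∧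
        IsLeast (ElasticNet.feasiblePowers (ElasticNet.coverageProb μ X h α γ) σ ε)
          (sInf (ElasticNet.feasiblePowers (ElasticNet.coverageProb μ X h α γ) σ ε))) ∧
      Tendsto
        (fun ε : ℝ =>
          sInf (ElasticNet.feasiblePowers (ElasticNet.coverageProb μ X h α γ) σ ε) /
            ElasticNet.optPower (γ ^ (-(2 / α))) α γ σ (μa * lr) ε)
        (𝓝[<] 1) (𝓝 1)) := by
  have hL : 0 < μa * lr := mul_pos hμa hlr
  have hα0 : 0 < α := by linarith
  refine ⟨fun κ hκ => ⟨fun P hP => ⟨ElasticNet.covFormula_noiseless hκ hγ hL P, ?_,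
    ElasticNet.covFormula_sub_covLinear hκ hα0 hγ hL σ hP⟩,
    fun ε _ hε1 => ElasticNet.isLeast_optPower_covLinear hκ hα0 hγ hL hσ hε1,
    fun ε hε hε1 => ElasticNet.isLeast_sInf_covFormula hκ hα0 hγ hL hσ hε hε1,
    ElasticNet.tendsto_sInf_div_optPower hκ hα0 hγ hL hσ⟩, ?_⟩
  · rw [ElasticNet.covLinear_eq hκ hα0 hγ hL, ElasticNet.lowNoiseCoeff, div_div,
      mul_comm _ P]
  · intro Ω _ μ _ X h hN
    have hκ : 0 ≤ γ ^ (-(2 / α)) := Real.rpow_nonneg hγ.le _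
    have hcov : ∀ τ P : ℝ, 0 < P → ElasticNet.coverageProb μ X h α γ τ P =
        ElasticNet.covFormula (γ ^ (-(2 / α))) α γ (μa * lr) τ P := fun τ P hP =>
      ElasticNet.coverageProb_eq_covFormula hL hγ hα hN hP
    -- Feasible powers are positive by definition, so agreement of the two coverages for P > 0, at
    -- noise levels 0 and σ, identifies the feasible sets.
    have hset : ∀ ε, ElasticNet.feasiblePowers (ElasticNet.coverageProb μ X h α γ) σ ε =
        ElasticNet.feasiblePowers
          (ElasticNet.covFormula (γ ^ (-(2 / α))) α γ (μa * lr)) σ ε := by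
      intro ε
      ext P
      refine and_congr_right fun hP => ?_
      rw [hcov 0 P hP, hcov σ P hP]
    refine ⟨fun τ P _ hP => hcov τ P hP, fun ε hε hε1 => ?_, ?_⟩
    · rw [hset]
      exact ElasticNet.isLeast_sInf_covFormula hκ hα0 hγ hL hσ hε hε1
    · simp_rw [hset]
      exact ElasticNet.tendsto_sInf_div_optPower hκ hα0 hγ hL hσ
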